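/- Let $G$ be a compact, connected, semisimple (real, finite-dimensional) Lie group with Lie algebra $\mathfrak g$, where semisimple means that the Killing form $B(X,Y)=\operatorname{tr}(\operatorname{ad}X\circ\operatorname{ad}Y)$ of $\mathfrak g$ is nondegenerate. Let $\mathfrak g^*$ be the dual of $\mathfrak g$, let $\mathrm{Ad}$ be the adjoint action of $G$ on $\mathfrak g$, let $\mathrm{Ad}^*_g\alpha=\alpha\circ \mathrm{Ad}_{g^{-1}}$ be the coadjoint action on $\mathfrak g^*$, and let $B^\flat:\mathfrak g\to\mathfrak g^*$, $B^\flat(X)(Y)=B(X,Y)$. For $X\in\mathfrak g$ write $O_X$ for the adjoint orbit of $X$, and for $\alpha\in\mathfrak g^*$ write $O_\alpha$ for the coadjoint orbit of $\alpha$. Then: 1. $B^\flat$ is a linear isomorphism and $B^\flat\circ \mathrm{Ad}_g=\mathrm{Ad}^*_g\circ B^\flat$ for all $g\in G$. 2. $B^\flat$ descends to a bijection $\widehat{B^\flat}:\mathfrak g/G\to\mathfrak g^*/G$, $[X]\mapsto[B^\flat X]$, of the orbit spaces, and $\widehat{B^\flat}$ is a diffeomorphism for the quotient smooth structures, that is,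 for the finest diffeologies that make the projections $\mathfrak g\to\mathfrak g/G$ and $\mathfrak g^*\to\mathfrak g^*/G$ smooth. 3. For every $X\in\mathfrak g$, with $\alpha=B^\flat(X)$, the orbits $O_X\subset\mathfrak g$ and $O_\alpha\subset\mathfrak g^*$ are embedded submanifolds; the tangent space $T_\nu O_\alpha$ at $\nu\in O_\alpha$ is the space of all values $\xi_{\mathfrak g^*}(\nu)$, $\xi\in\mathfrak g$, of fundamental vector fields of the coadjoint action; the formula $\omega_\nu(\xi_{\mathfrak g^*}(\nu),\eta_{\mathfrak g^*}(\nu))=-\nu([\xi,\eta])$ defines a symplectic form $\omega$ on $O_\alpha$ (the Kirillov–Kostant–Souriau form); $B^\flat$ restricts to a diffeomorphism $F:O_X\to O_\alpha$; and $F^*\omega$ is a symplectic form on $O_X$. Thus $F$ is a symplectomorphism from $(O_X,F^*\omega)$ onto $(O_\alpha,\omega)$. -/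

import Mathlib

open Manifold ContDiff Diffeology

noncomputable section

/-! ### The Lie algebra of a Lie group as a normed space

The tangent space at the identity is, as a topological vector space, the model space `E`. It gets
the norm of `E`, without changing its topology and its vector space structure. -/

section LieAlgebra

variable {E : Type*} [NormedAddCommGroup E] [NormedSpace ℝ E]
  {G : Type*} [TopologicalSpace G] [ChartedSpace E G] [Group G]

instance instNormGroupLieAlgebra : Norm (GroupLieAlgebra 𝓘(ℝ, E) G) :=
  ⟨fun v => norm (show E from v)⟩

theorem groupLieAlgebra_normedSpaceCore : NormedSpace.Core ℝ (GroupLieAlgebra 𝓘(ℝ, E) G) where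
  norm_nonneg v := norm_nonneg (show E from v)
  norm_smul c v := norm_smul c (show E from v)
  norm_triangle v w := norm_add_le (show E from v) (show E from w)
  norm_eq_zero_iff v := norm_eq_zero (a := (show E from v))

theorem groupLieAlgebra_topology_eq :
    (inferInstance : TopologicalSpace (GroupLieAlgebra 𝓘(ℝ, E) G)) =
      (PseudoEMetricSpace.ofSeminormedSpaceCore (groupLieAlgebra_normedSpaceCore
        (E := E) (G := G)).toCore).toUniformSpace.toTopologicalSpace := by
  let t : NormedAddCommGroup (GroupLieAlgebra 𝓘(ℝ, E) G) :=
    NormedAddCommGroup.ofCore groupLieAlgebra_normedSpaceCore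
  have hE : @IsTopologicalAddGroup (GroupLieAlgebra 𝓘(ℝ, E) G)
    (instTopologicalSpaceTangentSpace 𝓘(ℝ, E) (1 : G)) _ := inferInstance
  have ht : @IsTopologicalAddGroup (GroupLieAlgebra 𝓘(ℝ, E) G)
    t.toPseudoMetricSpace.toUniformSpace.toTopologicalSpace _ :=
    t.toSeminormedAddCommGroup.toIsTopologicalAddGroup
  refine IsTopologicalAddGroup.ext hE ht ?_
  have h1 := Metric.nhds_basis_ball (x := (0 : E))
  have h2 := Metric.nhds_basis_ball (x := (0 : GroupLieAlgebra 𝓘(ℝ, E) G))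
  refine Filter.HasBasis.ext h1 h2 ?_ ?_
  · intro r hr
    exact ⟨r, hr, fun v hv =>
      have hv' : ‖v‖ < r := (mem_ball_zero_iff (E := GroupLieAlgebra 𝓘(ℝ, E) G)).1 hv
      (mem_ball_zero_iff (E := E)).2 hv'⟩
  · intro r hr
    exact ⟨r, hr, fun v hv =>
      have hv' : ‖v‖ < r := (mem_ball_zero_iff (E := E)).1 hv
      (mem_ball_zero_iff (E := GroupLieAlgebra 𝓘(ℝ, E) G)).2 hv'⟩

instance instNormedAddCommGroupGroupLieAlgebra :
    NormedAddCommGroup (GroupLieAlgebra 𝓘(ℝ, E) G) :=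
  NormedAddCommGroup.ofCoreReplaceTopology groupLieAlgebra_normedSpaceCore
    groupLieAlgebra_topology_eq

instance instNormedSpaceGroupLieAlgebra : NormedSpace ℝ (GroupLieAlgebra 𝓘(ℝ, E) G) where
  norm_smul_le c v := (norm_smul c (show E from v)).le

instance instFiniteDimensionalGroupLieAlgebra [FiniteDimensional ℝ E] :
    FiniteDimensional ℝ (GroupLieAlgebra 𝓘(ℝ, E) G) :=
  inferInstanceAs (FiniteDimensional ℝ E)

instance instLEInftyMinSmoothness : ENat.LEInfty (minSmoothness ℝ 3) :=
  ⟨by rw [minSmoothness_of_isRCLikeNormedField]; exact ENat.LEInfty.out⟩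

end LieAlgebra

/-! ### The adjoint and the coadjoint action, and the Killing form -/

section Adjoint

variable (E : Type*) [NormedAddCommGroup E] [NormedSpace ℝ E]
  (G : Type*) [TopologicalSpace G] [ChartedSpace E G] [Group G]

/-- `Ad g` is the derivative at the identity of `x ↦ g x g⁻¹`. -/
def adMap (g : G) : GroupLieAlgebra 𝓘(ℝ, E) G →L[ℝ] GroupLieAlgebra 𝓘(ℝ, E) G :=
  (mfderiv 𝓘(ℝ, E) 𝓘(ℝ, E) (fun x : G => g * x * g⁻¹) 1 :)

variable [LieGroup 𝓘(ℝ, E) ∞ G]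

/-- The adjoint action of a Lie group on its Lie algebra. -/
def Ad : G →* (GroupLieAlgebra 𝓘(ℝ, E) G →L[ℝ] GroupLieAlgebra 𝓘(ℝ, E) G) where
  toFun := adMap E G
  map_one' := by
    have h : (fun x : G => (1 : G) * x * (1 : G)⁻¹) = id := by ext x; simp
    unfold adMap
    rw [h]
    exact mfderiv_id
  map_mul' g h := by
    have key : ∀ a b : G, MDifferentiableAt 𝓘(ℝ, E) 𝓘(ℝ, E) (fun x : G => a * x * a⁻¹) b :=
      fun a b => ((contMDiff_mul_right (I := 𝓘(ℝ, E)) (n := ∞) (a := a⁻¹)).comp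
        (contMDiff_mul_left (I := 𝓘(ℝ, E)) (n := ∞) (a := a))).contMDiffAt.mdifferentiableAt
          (by simp)
    have hc : (fun x : G => (g * h) * x * (g * h)⁻¹) =
        (fun x : G => g * x * g⁻¹) ∘ (fun x : G => h * x * h⁻¹) := by
      ext x; simp [mul_assoc]
    have hm := mfderiv_comp (1 : G) (key g (h * 1 * h⁻¹)) (key h 1)
    rw [← hc] at hm
    have e : ∀ y : G, y = 1 → ∀ v : E,
        (mfderiv 𝓘(ℝ, E) 𝓘(ℝ, E) (fun x : G => g * x * g⁻¹) y : E →L[ℝ] E) v =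
          (mfderiv 𝓘(ℝ, E) 𝓘(ℝ, E) (fun x : G => g * x * g⁻¹) 1 : E →L[ℝ] E) v := by
      rintro _ rfl v
      rfl
    refine ContinuousLinearMap.ext fun v => ?_
    exact (congrArg (fun L : E →L[ℝ] E => L v) hm).trans (e _ (by simp) _)

/-- The coadjoint action of a Lie group on the dual of its Lie algebra,
`(Ad* g α)(Y) = α (Ad g⁻¹ Y)`. -/
def coAd : G →* (StrongDual ℝ (GroupLieAlgebra 𝓘(ℝ, E) G) →L[ℝ]
    StrongDual ℝ (GroupLieAlgebra 𝓘(ℝ, E) G)) where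
  toFun g := ContinuousLinearMap.precomp ℝ (Ad E G g⁻¹)
  map_one' := by
    ext α Y
    simp
  map_mul' g h := by
    ext α Y
    simp

/-- The map `B♭ : 𝔤 → 𝔤*`, `B♭ X Y = B(X, Y)` with the Killing form `B(X, Y) = tr (ad X ∘ ad Y)`. -/
def killingFlat [FiniteDimensional ℝ E] [CompleteSpace E] :
    GroupLieAlgebra 𝓘(ℝ, E) G →ₗ[ℝ] StrongDual ℝ (GroupLieAlgebra 𝓘(ℝ, E) G) :=
  (LinearMap.toContinuousLinearMap (𝕜 := ℝ) (E := GroupLieAlgebra 𝓘(ℝ, E) G) (F' := ℝ)).toLinearMap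
    ∘ₗ killingForm ℝ (GroupLieAlgebra 𝓘(ℝ, E) G)

end Adjoint

/-! ### Orbits and orbit spaces of a linear action -/

section Orbits

variable {G : Type*} [Group G] {V : Type*} [NormedAddCommGroup V] [NormedSpace ℝ V]

/-- The orbit of `v` under the linear action `ρ`. -/
def orbit (ρ : G →* (V →L[ℝ] V)) (v : V) : Set V :=
  Set.range fun g => ρ g v

/-- Two vectors are equivalent when they lie in the same orbit. -/
def orbitSetoid (ρ : G →* (V →L[ℝ] V)) : Setoid V where
  r v w := w ∈ orbit ρ v
  iseqv :=
    { refl := fun v => ⟨1, by simp⟩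
      symm := by
        rintro v _ ⟨g, rfl⟩
        refine ⟨g⁻¹, ?_⟩
        change (ρ g⁻¹ * ρ g) v = v
        rw [← map_mul]
        simp
      trans := by
        rintro v _ _ ⟨g, rfl⟩ ⟨h, rfl⟩
        refine ⟨h * g, ?_⟩
        simp }

/-- The orbit space `V / G`. -/
def OrbitSpace (ρ : G →* (V →L[ℝ] V)) : Type _ :=
  Quotient (orbitSetoid ρ)

/-- The projection `π : V → V / G`. -/
def OrbitSpace.mk (ρ : G →* (V →L[ℝ] V)) (v : V) : OrbitSpace ρ :=
  Quotient.mk (orbitSetoid ρ) v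

/-- The quotient smooth structure on `V / G`: the finest diffeology for which `π` is smooth. Its
plots are the maps that locally lift to smooth maps into `V`. -/
instance instDiffeologicalSpaceOrbitSpace (ρ : G →* (V →L[ℝ] V)) :
    DiffeologicalSpace (OrbitSpace ρ) :=
  DiffeologicalSpace.generateFrom
    {q | ∃ p : EuclideanSpace ℝ (Fin q.1) → V, ContDiff ℝ ∞ p ∧ q.2 = OrbitSpace.mk ρ ∘ p}

/-- The value at `v` of the fundamental vector field of the action `ρ` attached to `ξ ∈ 𝔤`:
the derivative of the orbit map `g ↦ ρ g v` at the identity in the direction `ξ`. -/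
def fundamentalField {E : Type*} [NormedAddCommGroup E] [NormedSpace ℝ E]
    [TopologicalSpace G] [ChartedSpace E G] (ρ : G →* (V →L[ℝ] V))
    (ξ : GroupLieAlgebra 𝓘(ℝ, E) G) (v : V) : V :=
  mfderiv 𝓘(ℝ, E) 𝓘(ℝ, V) (fun g : G => ρ g v) 1 ξ

end Orbits

/-! ### Embedded submanifolds of a normed space -/

section Submanifold

variable {V : Type*} [NormedAddCommGroup V] [NormedSpace ℝ V]

/-- A manifold structure on `S ⊆ V` (with the subspace topology) that makes `S` an embedded
submanifold: the inclusion is a smooth embedding. Such a structure is unique up to equivalence of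
atlases. -/
def IsSubmanifoldStructure (S : Set V) (d : ℕ) [ChartedSpace (EuclideanSpace ℝ (Fin d)) S] : Prop :=
  IsManifold (𝓡 d) ∞ S ∧ IsSmoothEmbedding (𝓡 d) 𝓘(ℝ, V) ∞ (Subtype.val : S → V)

/-- `S` is an embedded submanifold of `V`. -/
def IsEmbeddedSubmanifold (S : Set V) : Prop :=
  ∃ (d : ℕ) (_ : ChartedSpace (EuclideanSpace ℝ (Fin d)) S), IsSubmanifoldStructure S d

/-- The derivative of the inclusion `S → V` at `p`, which identifies `T_p S` with a subspace
of `V`. -/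
def tangentInclusion (S : Set V) (d : ℕ) [ChartedSpace (EuclideanSpace ℝ (Fin d)) S] (p : S) :
    TangentSpace (𝓡 d) p →L[ℝ] V :=
  mfderiv (𝓡 d) 𝓘(ℝ, V) (Subtype.val : S → V) p

end Submanifold

/-! ### Symplectic forms on manifolds -/

section Symplectic

variable {E : Type*} [NormedAddCommGroup E] [NormedSpace ℝ E]
  {M : Type*} [TopologicalSpace M] [ChartedSpace E M]
  {E' : Type*} [NormedAddCommGroup E'] [NormedSpace ℝ E']
  {M' : Type*} [TopologicalSpace M'] [ChartedSpace E' M']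

variable (E M) in
/-- A (not necessarily continuous) 2-form on `M`: an alternating bilinear form on every tangent
space. -/
abbrev TwoForm : Type _ :=
  ∀ p : M, TangentSpace 𝓘(ℝ, E) p [⋀^Fin 2]→L[ℝ] ℝ

/-- The 2-form `σ` in the chart at `x`, that is, its pullback by the inverse of the chart. It is
meaningful on the target of the chart. -/
def TwoForm.inChart (σ : TwoForm E M) (x : M) : E → E [⋀^Fin 2]→L[ℝ] ℝ := fun y =>
  (σ ((extChartAt 𝓘(ℝ, E) x).symm y)).compContinuousLinearMap
    (mfderiv 𝓘(ℝ, E) 𝓘(ℝ, E) (extChartAt 𝓘(ℝ, E) x).symm y : E →L[ℝ] _)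

/-- A symplectic form: a smooth, closed and nondegenerate 2-form. -/
structure TwoForm.IsSymplectic (σ : TwoForm E M) : Prop where
  smooth : ∀ x : M, ContDiffOn ℝ ∞ (σ.inChart x) (extChartAt 𝓘(ℝ, E) x).target
  closed : ∀ x : M, ∀ y ∈ (extChartAt 𝓘(ℝ, E) x).target, extDeriv (σ.inChart x) y = 0
  nondegenerate : ∀ (p : M) (u : TangentSpace 𝓘(ℝ, E) p),
    (∀ v : TangentSpace 𝓘(ℝ, E) p, σ p ![u, v] = 0) → u = 0

/-- The pullback of a 2-form by a map. -/
def TwoForm.pullback (F : M → M') (σ : TwoForm E' M') : TwoForm E M := fun p =>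
  (σ (F p)).compContinuousLinearMap (mfderiv 𝓘(ℝ, E) 𝓘(ℝ, E') F p)

/-- A diffeomorphism `F : (M, Ω) → (M', σ)` is a symplectomorphism when `F^* σ = Ω`. -/
def IsSymplectomorphism (F : M ≃ₘ^∞⟮𝓘(ℝ, E), 𝓘(ℝ, E')⟯ M') (Ω : TwoForm E M)
    (σ : TwoForm E' M') : Prop :=
  TwoForm.pullback F σ = Ω

end Symplectic

section KKS

variable {E : Type*} [NormedAddCommGroup E] [NormedSpace ℝ E]
  {G : Type*} [TopologicalSpace G] [ChartedSpace E G] [Group G] [LieGroup 𝓘(ℝ, E) ∞ G]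

/-- The Kirillov-Kostant-Souriau form on the coadjoint orbit `O` of `α`, given on the values of
fundamental vector fields at `ν ∈ O` by `σ_ν (ξ_{𝔤*}(ν), η_{𝔤*}(ν)) = -ν([ξ, η])`. -/
def IsKKSForm (α : StrongDual ℝ (GroupLieAlgebra 𝓘(ℝ, E) G)) (d : ℕ)
    [ChartedSpace (EuclideanSpace ℝ (Fin d)) (orbit (coAd E G) α)]
    (σ : TwoForm (EuclideanSpace ℝ (Fin d)) (orbit (coAd E G) α)) : Prop :=
  ∀ (ν : orbit (coAd E G) α) (u v : TangentSpace (𝓡 d) ν) (ξ η : GroupLieAlgebra 𝓘(ℝ, E) G),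
    tangentInclusion _ d ν u = fundamentalField (coAd E G) ξ ν.1 →
    tangentInclusion _ d ν v = fundamentalField (coAd E G) η ν.1 →
    σ ν ![u, v] = -(ν.1 ⁅ξ, η⁆)

end KKS

end

/-!
Left translation by `g` is conjugation by `g` followed by right translation; the mixed second
derivatives of this identity in the chart at `1` give `d Ad = ad`. Fundamental vector fields being
equivariant, `Ad` preserves the bracket, hence the Killing form. So `B♭` intertwines `Ad` and `Ad*`,
and being a linear isomorphism it passes to orbits and to orbit spaces.

For a smooth linear action of a compact group the orbit map has constant rank, and compactness makes
it open onto the orbit. The local sections given by the constant rank theorem therefore parametrize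
the orbit, which makes it an embedded submanifold with the fundamental vectors as tangent vectors.

The Kirillov–Kostant–Souriau form at `ν` is well defined and nondegenerate because
`ξ_{𝔤*}(ν) = -ν ∘ ad ξ`. Closedness uses that `α = B♭ X` factors as `α = λ ∘ ad` with
`λ T = tr (ad X ∘ T)`: along a smooth map `g` into `G` the form pulls back, under `Ad*(g) α`, to the
exterior derivative of the 1-form `λ (Ad(g)⁻¹ d Ad(g))`, by the Maurer–Cartan equation.
-/

open Filter Topology

/-! ### The constant rank theorem -/

section LocalInverse

variable {E F : Type*} [NormedAddCommGroup E] [NormedSpace ℝ E] [CompleteSpace E]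
  [NormedAddCommGroup F] [NormedSpace ℝ F]

theorem exists_contDiffAt_localInverse {Φ : E → F} {Φ' : E ≃L[ℝ] F} {e : E}
    (hΦ : ∀ᶠ x in 𝓝 e, ContDiffAt ℝ ∞ Φ x) (hΦ' : HasFDerivAt Φ (Φ' : E →L[ℝ] F) e) :
    ∃ ψ : F → E, ψ (Φ e) = e ∧ (∀ᶠ z in 𝓝 (Φ e), ContDiffAt ℝ ∞ ψ z) ∧
      (∀ᶠ x in 𝓝 e, ψ (Φ x) = x) ∧ ∀ᶠ z in 𝓝 (Φ e), Φ (ψ z) = z := by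
  have hΦe : ContDiffAt ℝ ∞ Φ e := hΦ.self_of_nhds
  have strict : HasStrictFDerivAt Φ (Φ' : E →L[ℝ] F) e := hΦe.hasStrictFDerivAt' hΦ' (by simp)
  let T := strict.toOpenPartialHomeomorph Φ
  have mem_target : Φ e ∈ T.target := strict.image_mem_toOpenPartialHomeomorph_target
  have symm_apply : T.symm (Φ e) = e := T.left_inv strict.mem_toOpenPartialHomeomorph_source
  have tendsto_symm : Tendsto T.symm (𝓝 (Φ e)) (𝓝 e) := by
    simpa only [ContinuousAt, symm_apply] using T.continuousAt_symm mem_target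
  have invertible : ∀ᶠ x in 𝓝 e, ∃ L : E ≃L[ℝ] F, (L : E →L[ℝ] F) = fderiv ℝ Φ x :=
    (hΦe.fderiv_right (m := 0) (by simp)).continuousAt.eventually
      (by rw [hΦ'.fderiv]; exact ContinuousLinearEquiv.nhds Φ')
  refine ⟨T.symm, symm_apply, ?_, strict.eventually_left_inverse, strict.eventually_right_inverse⟩
  filter_upwards [T.open_target.mem_nhds mem_target, tendsto_symm.eventually invertible,
    tendsto_symm.eventually hΦ] with z hz ⟨L, hL⟩ hΦz
  refine T.contDiffAt_symm hz (f₀' := L) ?_ hΦz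
  rw [hL]
  exact (hΦz.differentiableAt (by simp)).hasFDerivAt

end LocalInverse

section ConstantRank

variable {E : Type*} [NormedAddCommGroup E] [NormedSpace ℝ E]
  {K : Type*} [NormedAddCommGroup K] [NormedSpace ℝ K]
  {V : Type*} [NormedAddCommGroup V] [NormedSpace ℝ V]
  {W : Type*} [NormedAddCommGroup W] [NormedSpace ℝ W]

theorem eventually_eq_of_fderiv_snd_eq_zero {h : W × K → V} {z₀ : W × K}
    (hh : ∀ᶠ z in 𝓝 z₀, DifferentiableAt ℝ h z ∧ ∀ κ, fderiv ℝ h z (0, κ) = 0) :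
    ∀ᶠ z in 𝓝 z₀, h z = h (z.1, z₀.2) := by
  obtain ⟨r, r_pos, hball⟩ := Metric.eventually_nhds_iff_ball.1 hh
  filter_upwards [Metric.ball_mem_nhds z₀ r_pos] with z hz
  rw [← Prod.mk.eta (p := z₀), ← ball_prod_same] at hball hz
  have deriv_zero : ∀ s ∈ Metric.ball z₀.2 r,
      HasFDerivAt (fun s => h (z.1, s)) (0 : K →L[ℝ] V) s := fun s hs => by
    obtain ⟨hd, h0⟩ := hball (z.1, s) ⟨hz.1, hs⟩
    refine (hd.hasFDerivAt.comp s (hasFDerivAt_prodMk_right z.1 s)).congr_fderiv ?_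
    ext1 κ
    exact h0 κ
  exact Metric.isOpen_ball.is_const_of_fderiv_eq_zero (𝕜 := ℝ)
    (convex_ball z₀.2 r).isPreconnected
    (fun s hs => (deriv_zero s hs).differentiableAt.differentiableWithinAt)
    (fun s hs => (deriv_zero s hs).fderiv) hz.2 (Metric.mem_ball_self r_pos)

theorem apply_eq_zero_of_finrank_range_le [FiniteDimensional ℝ V] [FiniteDimensional ℝ W]
    {A : E →L[ℝ] V} {P : V →L[ℝ] W}
    (hA : Module.finrank ℝ A.range ≤ Module.finrank ℝ W)
    (hPA : Function.Surjective (P ∘ A)) {x : E} (hx : P (A x) = 0) : A x = 0 := by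
  let p : A.range →ₗ[ℝ] W := P.toLinearMap ∘ₗ A.range.subtype
  have p_surjective : Function.Surjective p := fun t =>
    let ⟨y, hy⟩ := hPA t
    ⟨⟨A y, y, rfl⟩, hy⟩
  have p_injective : Function.Injective p :=
    (LinearMap.injective_iff_surjective_of_finrank_eq_finrank
      (hA.antisymm (LinearMap.finrank_le_finrank_of_surjective p_surjective))).2 p_surjective
  exact congrArg Subtype.val (p_injective (a₁ := ⟨A x, x, rfl⟩) (hx.trans (map_zero p).symm))

theorem fderiv_comp_snd_eq_zero_of_finrank_range_le [FiniteDimensional ℝ V]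
    [FiniteDimensional ℝ W] {f : E → V} {ψ : W × K → E} {P : V →L[ℝ] W} {z : W × K}
    (hf : DifferentiableAt ℝ f (ψ z)) (hψ : DifferentiableAt ℝ ψ z)
    (hP : ∀ᶠ y in 𝓝 z, P (f (ψ y)) = y.1)
    (hr : Module.finrank ℝ (fderiv ℝ f (ψ z)).range ≤ Module.finrank ℝ W)
    (κ : K) : fderiv ℝ (f ∘ ψ) z (0, κ) = 0 := by
  have hcomp := hf.hasFDerivAt.comp z hψ.hasFDerivAt
  have hPcomp : ∀ w, P (fderiv ℝ f (ψ z) (fderiv ℝ ψ z w)) = w.1 := fun w =>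
    ContinuousLinearMap.ext_iff.1 ((P.hasFDerivAt.comp z hcomp).unique
      (hasFDerivAt_fst.congr_of_eventuallyEq hP)) w
  rw [hcomp.fderiv]
  exact apply_eq_zero_of_finrank_range_le hr (fun t => ⟨fderiv ℝ ψ z (t, 0), hPcomp (t, 0)⟩)
    (hPcomp (0, κ))

theorem exists_coordinates_range_ker [FiniteDimensional ℝ E] [FiniteDimensional ℝ V]
    (L : E →L[ℝ] V) {d : ℕ} (hd : Module.finrank ℝ L.range = d) :
    ∃ (P : V →L[ℝ] EuclideanSpace ℝ (Fin d)) (Q : E →L[ℝ] L.ker)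
      (Φ : E ≃L[ℝ] EuclideanSpace ℝ (Fin d) × L.ker), ∀ x, Φ x = (P (L x), Q x) := by
  let e : L.range ≃ₗ[ℝ] EuclideanSpace ℝ (Fin d) := LinearEquiv.ofFinrankEq _ _ (by simp [hd])
  obtain ⟨p, hp⟩ := e.toLinearMap.exists_extend
  obtain ⟨q, hq⟩ := (LinearMap.id : L.ker →ₗ[ℝ] L.ker).exists_extend
  have pL_apply (x : E) : p (L x) = e ⟨L x, x, rfl⟩ := LinearMap.congr_fun hp ⟨L x, x, rfl⟩
  have q_apply (k : L.ker) : q k = k := LinearMap.congr_fun hq k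
  have ker_pL : (p ∘ₗ L.toLinearMap).ker = L.ker := by
    ext x
    exact (Eq.congr_left (pL_apply x)).trans
      (e.map_eq_zero_iff.trans ⟨congrArg Subtype.val, fun hx => Subtype.ext hx⟩)
  have range_pL : (p ∘ₗ L.toLinearMap).range = ⊤ := LinearMap.range_eq_top.2 fun t => by
    obtain ⟨⟨_, x, rfl⟩, ht⟩ := e.surjective t
    exact ⟨x, (pL_apply x).trans ht⟩
  let Φ := LinearMap.equivProdOfSurjectiveOfIsCompl (p ∘ₗ L.toLinearMap) q range_pL
    (LinearMap.range_eq_top.2 fun k => ⟨k, q_apply k⟩)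
    (by rw [ker_pL]; exact LinearMap.isCompl_of_proj q_apply)
  exact ⟨p.toContinuousLinearMap, q.toContinuousLinearMap, Φ.toContinuousLinearEquiv,
    fun _ => rfl⟩

/-- `γ` is a smooth local section of `P ∘ f` at `P (f e)`, and `f` is constant along the fibres of
`P ∘ f` near `e`. -/
structure IsConstantRankSection (f : E → V) (e : E) (P : V →L[ℝ] W) (γ : W → E) : Prop where
  contDiffAt : ∀ᶠ t in 𝓝 (P (f e)), ContDiffAt ℝ ∞ γ t
  apply_base : γ (P (f e)) = e
  right_inv : ∀ᶠ t in 𝓝 (P (f e)), P (f (γ t)) = t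
  factorization : ∀ᶠ x in 𝓝 e, f (γ (P (f x))) = f x

theorem exists_isConstantRankSection [FiniteDimensional ℝ E] [FiniteDimensional ℝ V]
    {f : E → V} {e : E} (hf : ∀ᶠ x in 𝓝 e, ContDiffAt ℝ ∞ f x) {d : ℕ}
    (hd : Module.finrank ℝ (fderiv ℝ f e).range = d)
    (hr : ∀ᶠ x in 𝓝 e, Module.finrank ℝ (fderiv ℝ f x).range ≤ d) :
    ∃ (P : V →L[ℝ] EuclideanSpace ℝ (Fin d)) (γ : EuclideanSpace ℝ (Fin d) → E),
      IsConstantRankSection f e P γ := by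
  obtain ⟨P, Q, Φ', hΦ'⟩ := exists_coordinates_range_ker (fderiv ℝ f e) hd
  let Φ : E → EuclideanSpace ℝ (Fin d) × (fderiv ℝ f e).ker := fun x => (P (f x), Q x)
  have hΦ : ∀ᶠ x in 𝓝 e, ContDiffAt ℝ ∞ Φ x := hf.mono fun x hx =>
    (P.contDiff.contDiffAt.comp x hx).prodMk Q.contDiff.contDiffAt
  have hΦe : HasFDerivAt Φ (Φ' : E →L[ℝ] _) e :=
    ((P.hasFDerivAt.comp e (hf.self_of_nhds.differentiableAt (by simp)).hasFDerivAt).prodMk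
      Q.hasFDerivAt).congr_fderiv (ContinuousLinearMap.ext fun x => (hΦ' x).symm)
  obtain ⟨ψ, ψ_base, ψ_smooth, ψ_left, ψ_right⟩ := exists_contDiffAt_localInverse hΦ hΦe
  have ψ_tendsto : Tendsto ψ (𝓝 (Φ e)) (𝓝 e) := by
    simpa only [ContinuousAt, ψ_base] using ψ_smooth.self_of_nhds.continuousAt
  have fderiv_fibre : ∀ᶠ z in 𝓝 (Φ e), DifferentiableAt ℝ (f ∘ ψ) z ∧
      ∀ κ, fderiv ℝ (f ∘ ψ) z (0, κ) = 0 := by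
    filter_upwards [ψ_right.eventually_nhds, ψ_smooth, ψ_tendsto.eventually hf,
      ψ_tendsto.eventually hr] with z hz hψz hfz hrz
    have hψd := hψz.differentiableAt (by simp)
    have hfd := hfz.differentiableAt (by simp)
    exact ⟨hfd.comp z hψd, fderiv_comp_snd_eq_zero_of_finrank_range_le hfd hψd
      (hz.mono fun y hy => congrArg Prod.fst hy) (by simpa using hrz)⟩
  have slice_tendsto : Tendsto (fun t => (t, Q e)) (𝓝 (P (f e))) (𝓝 (Φ e)) :=
    (continuous_id.prodMk continuous_const).tendsto _
  refine ⟨P, fun t => ψ (t, Q e), ?_, ψ_base, ?_, ?_⟩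
  · filter_upwards [slice_tendsto.eventually ψ_smooth] with t ht
    exact ContDiffAt.comp (g := ψ) t ht (contDiffAt_id.prodMk contDiffAt_const)
  · filter_upwards [slice_tendsto.eventually ψ_right] with t ht
    exact congrArg Prod.fst ht
  · filter_upwards [ψ_left, hΦ.self_of_nhds.continuousAt.eventually
      (eventually_eq_of_fderiv_snd_eq_zero fderiv_fibre)] with x hx hconst
    exact hconst.symm.trans (congrArg f hx)

end ConstantRank

/-! ### Local multiplications -/

section PartialDerivatives

variable {E F V : Type*} [NormedAddCommGroup E] [NormedSpace ℝ E]
  [NormedAddCommGroup F] [NormedSpace ℝ F] [NormedAddCommGroup V] [NormedSpace ℝ V]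

theorem eventually_differentiableAt_of_contDiffAt {n : ℕ∞ω} {f : E → V} {x : E}
    (hf : ContDiffAt ℝ n f x) (hn : n ≠ 0) : ∀ᶠ y in 𝓝 x, DifferentiableAt ℝ f y :=
  ((hf.of_le (ENat.one_le_iff_ne_zero_withTop.2 hn)).eventually (by simp)).mono
    fun _ hy => hy.differentiableAt (by simp)

theorem hasFDerivAt_comp_prodMk_left {m : E × F → V} {a : E} {b : F}
    (hm : DifferentiableAt ℝ m (a, b)) :
    HasFDerivAt (fun x => m (x, b)) (fderiv ℝ m (a, b) ∘L .inl ℝ E F) a :=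
  hm.hasFDerivAt.comp (f := fun x => (x, b)) a (hasFDerivAt_prodMk_left a b)

theorem hasFDerivAt_comp_prodMk_right {m : E × F → V} {a : E} {b : F}
    (hm : DifferentiableAt ℝ m (a, b)) :
    HasFDerivAt (fun y => m (a, y)) (fderiv ℝ m (a, b) ∘L .inr ℝ E F) b :=
  hm.hasFDerivAt.comp (f := fun y => (a, y)) b (hasFDerivAt_prodMk_right a b)

theorem fderiv_apply_prodMk_zero_left {m : E × F → V} {a : E} {b : F}
    (hm : DifferentiableAt ℝ m (a, b)) (w : F) :
    fderiv ℝ m (a, b) (0, w) = fderiv ℝ (fun y => m (a, y)) b w :=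
  (ContinuousLinearMap.ext_iff.1 (hasFDerivAt_comp_prodMk_right hm).fderiv w).symm

theorem hasFDerivAt_fderiv_prodMk_left_apply {m : E × F → V} {a : E} {b : F}
    (hm : DifferentiableAt ℝ (fderiv ℝ m) (a, b)) (w : E × F) :
    HasFDerivAt (fun x => fderiv ℝ m (x, b) w)
      ((fderiv ℝ (fderiv ℝ m) (a, b) ∘L .inl ℝ E F).flip w) a :=
  ((hasFDerivAt_comp_prodMk_left hm).clm_apply (hasFDerivAt_const w a)).congr_fderiv
    (by ext v; simp)

end PartialDerivatives

section LocalMultiplication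

variable {E : Type*} [NormedAddCommGroup E] [NormedSpace ℝ E] {m : E × E → E} {e : E}

theorem lieBracket_fderiv_local_mul (hm : DifferentiableAt ℝ (fderiv ℝ m) (e, e))
    (hunit : ∀ w, fderiv ℝ m (e, e) (0, w) = w) (ξ η : E) :
    VectorField.lieBracket ℝ (fun x => fderiv ℝ m (x, e) (0, ξ))
        (fun x => fderiv ℝ m (x, e) (0, η)) e =
      fderiv ℝ (fderiv ℝ m) (e, e) (ξ, 0) (0, η) -
        fderiv ℝ (fderiv ℝ m) (e, e) (η, 0) (0, ξ) := by
  rw [VectorField.lieBracket, (hasFDerivAt_fderiv_prodMk_left_apply hm _).fderiv,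
    (hasFDerivAt_fderiv_prodMk_left_apply hm _).fderiv, hunit, hunit]
  simp

-- Differentiating `∂₂m(x, e) Y = ∂₁m(e, x) (A x Y)` at `e` in the direction `ξ` expresses `A' ξ Y`
-- through two mixed second derivatives of `m`, whose difference is the bracket by symmetry.
theorem fderiv_conj_eq_lieBracket (hm : ContDiffAt ℝ 2 m (e, e))
    (hr : ∀ᶠ x in 𝓝 e, m (x, e) = x) {A : E → E →L[ℝ] E} (hA : DifferentiableAt ℝ A e)
    (hAe : A e = .id ℝ E)
    (hconj : ∀ᶠ x in 𝓝 e, ∀ Y, fderiv ℝ m (x, e) (0, Y) = fderiv ℝ m (e, x) (A x Y, 0))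
    (ξ Y : E) :
    fderiv ℝ A e ξ Y = VectorField.lieBracket ℝ (fun x => fderiv ℝ m (x, e) (0, ξ))
      (fun x => fderiv ℝ m (x, e) (0, Y)) e := by
  have hm₁ : DifferentiableAt ℝ m (e, e) := hm.differentiableAt (by simp)
  have hm₂ : DifferentiableAt ℝ (fderiv ℝ m) (e, e) :=
    (hm.fderiv_right (m := 1) (by norm_num)).differentiableAt (by simp)
  have symm : IsSymmSndFDerivAt ℝ m (e, e) :=
    hm.isSymmSndFDerivAt (by rw [minSmoothness_of_isRCLikeNormedField])
  have unit_left (w : E) : fderiv ℝ m (e, e) (w, 0) = w :=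
    ContinuousLinearMap.ext_iff.1 ((hasFDerivAt_comp_prodMk_left hm₁).unique
      ((hasFDerivAt_id e).congr_of_eventuallyEq hr)) w
  have unit_right (w : E) : fderiv ℝ m (e, e) (0, w) = w := by
    rw [hconj.self_of_nhds w, hAe, unit_left, ContinuousLinearMap.id_apply]
  have hAY : HasFDerivAt (fun x => (A x Y, (0 : E)))
      ((fderiv ℝ A e).flip Y |>.prod (0 : E →L[ℝ] E)) e :=
    ((hA.hasFDerivAt.clm_apply (hasFDerivAt_const Y e)).congr_fderiv
      (by ext; simp)).prodMk (hasFDerivAt_const _ _)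
  have derivatives_agree := (hasFDerivAt_fderiv_prodMk_left_apply hm₂ (0, Y)).unique
    (((hasFDerivAt_comp_prodMk_right hm₂).clm_apply hAY).congr_of_eventuallyEq
      (hconj.mono fun x hx => hx Y))
  have second_order : fderiv ℝ (fderiv ℝ m) (e, e) (ξ, 0) (0, Y) =
      fderiv ℝ A e ξ Y + fderiv ℝ (fderiv ℝ m) (e, e) (0, ξ) (Y, 0) := by
    simpa [hAe, unit_left] using ContinuousLinearMap.ext_iff.1 derivatives_agree ξ
  rw [lieBracket_fderiv_local_mul hm₂ unit_right, second_order, symm.eq (0, ξ) (Y, 0),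
    add_sub_cancel_right]

end LocalMultiplication

/-! ### The adjoint representation in the chart at the identity -/

section Charts

variable {E : Type*} [NormedAddCommGroup E] [NormedSpace ℝ E]
  {M : Type*} [TopologicalSpace M] [ChartedSpace E M]
  {F : Type*} [NormedAddCommGroup F] [NormedSpace ℝ F]
  {N : Type*} [TopologicalSpace N] [ChartedSpace F N]

theorem mfderiv_eq_fderiv_extChartAt {f : M → N} {x : M} (hf : MDiffAt f x) :
    (show E →L[ℝ] F from mfderiv% f x) =
      fderiv ℝ (extChartAt 𝓘(ℝ, F) (f x) ∘ f ∘ (extChartAt 𝓘(ℝ, E) x).symm)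
        (extChartAt 𝓘(ℝ, E) x x) := by
  have h : (mfderiv% f x : E →L[ℝ] F) =
      fderivWithin ℝ (writtenInExtChartAt 𝓘(ℝ, E) 𝓘(ℝ, F) x f) (Set.range 𝓘(ℝ, E))
        (extChartAt 𝓘(ℝ, E) x x) := hf.mfderiv
  rwa [modelWithCornersSelf_coe, Set.range_id, fderivWithin_univ] at h

variable {p : M}

theorem contDiffAt_extChartAt_comp {u : F → M} {x : F} (hu : CMDiffAt ∞ u x) (hx : u x = p) :
    ContDiffAt ℝ ∞ (fun y => extChartAt 𝓘(ℝ, E) p (u y)) x := by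
  rw [← contMDiffAt_iff_contDiffAt]
  refine ContMDiffAt.comp (I' := 𝓘(ℝ, E)) x ?_ hu
  rw [hx]
  exact contMDiffAt_extChartAt

variable [IsManifold 𝓘(ℝ, E) ∞ M]

theorem contMDiffAt_extChartAt_symm_comp {f : F → E} {x : F} (hf : ContDiffAt ℝ ∞ f x)
    (hx : f x = extChartAt 𝓘(ℝ, E) p p) :
    CMDiffAt ∞ (fun y => (extChartAt 𝓘(ℝ, E) p).symm (f y)) x := by
  refine ContMDiffAt.comp (I' := 𝓘(ℝ, E)) x ?_ hf.contMDiffAt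
  rw [hx]
  exact (contMDiffOn_extChartAt_symm p).contMDiffAt (extChartAt_target_mem_nhds p)

theorem eventually_contMDiffAt_extChartAt_symm {x : E} (hx : x ∈ (extChartAt 𝓘(ℝ, E) p).target) :
    ∀ᶠ y in 𝓝 x, CMDiffAt ∞ (extChartAt 𝓘(ℝ, E) p).symm y := by
  filter_upwards [(isOpen_extChartAt_target p).mem_nhds hx] with y hy
  exact (contMDiffOn_extChartAt_symm p).contMDiffAt ((isOpen_extChartAt_target p).mem_nhds hy)

theorem mpullbackWithin_extChartAt_symm_apply (X : ∀ q : M, TangentSpace 𝓘(ℝ, E) q) {x : E}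
    (hx : x ∈ (extChartAt 𝓘(ℝ, E) p).target) :
    VectorField.mpullbackWithin 𝓘(ℝ, E) 𝓘(ℝ, E) (extChartAt 𝓘(ℝ, E) p).symm X
        (Set.range 𝓘(ℝ, E)) x =
      mfderiv% (extChartAt 𝓘(ℝ, E) p) ((extChartAt 𝓘(ℝ, E) p).symm x)
        (X ((extChartAt 𝓘(ℝ, E) p).symm x)) := by
  rw [VectorField.mpullbackWithin_apply, ContinuousLinearMap.inverse_eq
    (mfderivWithin_extChartAt_symm_comp_mfderiv_extChartAt hx)
    (mfderiv_extChartAt_comp_mfderivWithin_extChartAt_symm hx)]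
  rfl

end Charts

section ChartAtOne

variable {E : Type*} [NormedAddCommGroup E] [NormedSpace ℝ E]
  {G : Type*} [TopologicalSpace G] [ChartedSpace E G] [Group G]

local notation "𝔤" => GroupLieAlgebra 𝓘(ℝ, E) G
local notation "φ₁" => extChartAt 𝓘(ℝ, E) (1 : G)
local notation "φ₁⁻¹" => PartialEquiv.symm (extChartAt 𝓘(ℝ, E) (1 : G))

variable (E G) in
/-- The multiplication of `G` in the chart at `1`. -/
noncomputable def chartMul (p : E × E) : E :=
  φ₁ (φ₁⁻¹ p.1 * φ₁⁻¹ p.2)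

variable (E) in
/-- Conjugation by `g` in the chart at `1`. -/
noncomputable def chartConj (g : G) (y : E) : E :=
  φ₁ (g * φ₁⁻¹ y * g⁻¹)

variable (E G) in
/-- The adjoint action, in the chart at `1`, of the group element with coordinates `x`. -/
noncomputable def chartAd (x : E) : E →L[ℝ] E :=
  fderiv ℝ (chartConj E (φ₁⁻¹ x)) (φ₁ 1)

variable (E G) in
/-- The Lie algebra of `G` is, as a topological vector space, the model space. -/
noncomputable def groupLieAlgebraEquiv : 𝔤 ≃L[ℝ] E :=
  ContinuousLinearEquiv.refl ℝ E

variable (E G) in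
/-- Endomorphisms of the Lie algebra of `G` as endomorphisms of the model space. -/
noncomputable def endGroupLieAlgebraEquiv : (𝔤 →L[ℝ] 𝔤) ≃L[ℝ] (E →L[ℝ] E) :=
  (groupLieAlgebraEquiv E G).arrowCongr (groupLieAlgebraEquiv E G)

/-- The left-invariant vector field of `v` in the chart at `1`. -/
noncomputable def chartInvariantField (v : 𝔤) : E → E :=
  VectorField.mpullbackWithin 𝓘(ℝ, E) 𝓘(ℝ, E) φ₁⁻¹ (mulInvariantVectorField v) (Set.range 𝓘(ℝ, E))

theorem chartOne_symm_apply : φ₁⁻¹ (φ₁ 1) = 1 :=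
  extChartAt_to_inv (I := 𝓘(ℝ, E)) (1 : G)

theorem chartConj_base (g : G) : chartConj E g (φ₁ 1) = φ₁ 1 := by
  rw [chartConj, chartOne_symm_apply, mul_one, mul_inv_cancel]

theorem eventually_chartMul_base_right : ∀ᶠ x in 𝓝 (φ₁ 1), chartMul E G (x, φ₁ 1) = x := by
  filter_upwards [extChartAt_target_mem_nhds (I := 𝓘(ℝ, E)) (1 : G)] with x hx
  simp only [chartMul, chartOne_symm_apply, mul_one]
  exact (φ₁).right_inv hx

variable [LieGroup 𝓘(ℝ, E) ∞ G]

theorem contMDiff_conj (g : G) : CMDiff ∞ (fun x : G => g * x * g⁻¹) :=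
  (contMDiff_mul_right (I := 𝓘(ℝ, E)) (a := g⁻¹)).comp contMDiff_mul_left

theorem contDiffAt_chartMul : ContDiffAt ℝ ∞ (chartMul E G) (φ₁ 1, φ₁ 1) :=
  contDiffAt_extChartAt_comp
    ((contMDiffAt_extChartAt_symm_comp contDiffAt_fst rfl).mul
      (contMDiffAt_extChartAt_symm_comp contDiffAt_snd rfl))
    (by simp only [chartOne_symm_apply, mul_one])

theorem contDiffAt_uncurry_chartConj :
    ContDiffAt ℝ ∞ (Function.uncurry fun x : E => chartConj E (φ₁⁻¹ x)) (φ₁ 1, φ₁ 1) := by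
  have hfst : ContMDiffAt 𝓘(ℝ, E × E) 𝓘(ℝ, E) ∞ (fun p : E × E => φ₁⁻¹ p.1) (φ₁ 1, φ₁ 1) :=
    contMDiffAt_extChartAt_symm_comp contDiffAt_fst rfl
  exact contDiffAt_extChartAt_comp
    ((hfst.mul (contMDiffAt_extChartAt_symm_comp contDiffAt_snd rfl)).mul hfst.inv)
    (by simp only [chartOne_symm_apply, mul_one, inv_one])

theorem contDiffAt_chartAd : ContDiffAt ℝ ∞ (chartAd E G) (φ₁ 1) :=
  ContDiffAt.fderiv contDiffAt_uncurry_chartConj contDiffAt_const (by simp)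

theorem Ad_apply_eq_fderiv_chartConj (g : G) (Y : E) :
    (Ad E G g Y : E) = fderiv ℝ (chartConj E g) (φ₁ 1) Y := by
  have hd : MDiffAt (fun x : G => g * x * g⁻¹) 1 :=
    (contMDiff_conj g).contMDiffAt.mdifferentiableAt (by simp)
  have chart_eq : ∀ z : G, z = 1 →
      fderiv ℝ (extChartAt 𝓘(ℝ, E) z ∘ (fun x : G => g * x * g⁻¹) ∘ φ₁⁻¹) (φ₁ 1) Y =
      fderiv ℝ (chartConj E g) (φ₁ 1) Y := by
    rintro _ rfl
    rfl
  exact (ContinuousLinearMap.ext_iff.1 (mfderiv_eq_fderiv_extChartAt hd) Y).trans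
    (chart_eq (g * 1 * g⁻¹) (by simp))

theorem chartAd_base : chartAd E G (φ₁ 1) = .id ℝ E := by
  ext Y
  rw [chartAd, ← Ad_apply_eq_fderiv_chartConj, chartOne_symm_apply, map_one]
  rfl

theorem eventually_differentiableAt_chartMul_right :
    ∀ᶠ x in 𝓝 (φ₁ 1), DifferentiableAt ℝ (chartMul E G) (x, φ₁ 1) :=
  ((continuous_id.prodMk continuous_const).tendsto (φ₁ 1)).eventually
    (eventually_differentiableAt_of_contDiffAt contDiffAt_chartMul (by simp))

theorem eventually_chartMul_eq_chartMul_chartConj (x : E) :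
    ∀ᶠ y in 𝓝 (φ₁ 1), chartMul E G (x, y) = chartMul E G (chartConj E (φ₁⁻¹ x) y, x) := by
  have conj_mem_source : ∀ᶠ y in 𝓝 (φ₁ 1), φ₁⁻¹ x * φ₁⁻¹ y * (φ₁⁻¹ x)⁻¹ ∈ (φ₁).source := by
    refine ((contMDiff_conj (E := E) (φ₁⁻¹ x)).continuous.continuousAt.comp
      (continuousAt_extChartAt_symm (I := 𝓘(ℝ, E)) (1 : G))).eventually ?_
    rw [Function.comp_apply, chartOne_symm_apply, mul_one, mul_inv_cancel]
    exact extChartAt_source_mem_nhds (I := 𝓘(ℝ, E)) (1 : G)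
  filter_upwards [conj_mem_source] with y hy
  simp only [chartMul, chartConj]
  rw [(φ₁).left_inv hy, inv_mul_cancel_right]

theorem eventually_fderiv_chartMul_eq : ∀ᶠ x in 𝓝 (φ₁ 1), ∀ Y : E,
    fderiv ℝ (chartMul E G) (x, φ₁ 1) (0, Y) =
      fderiv ℝ (chartMul E G) (φ₁ 1, x) (chartAd E G x Y, 0) := by
  have mul_left : ∀ᶠ x in 𝓝 (φ₁ 1), DifferentiableAt ℝ (chartMul E G) (φ₁ 1, x) :=
    ((continuous_const.prodMk continuous_id).tendsto (φ₁ 1)).eventually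
      (eventually_differentiableAt_of_contDiffAt contDiffAt_chartMul (by simp))
  have conj : ∀ᶠ x in 𝓝 (φ₁ 1), DifferentiableAt ℝ
      (Function.uncurry fun x : E => chartConj E (φ₁⁻¹ x)) (x, φ₁ 1) :=
    ((continuous_id.prodMk continuous_const).tendsto (φ₁ 1)).eventually
      (eventually_differentiableAt_of_contDiffAt contDiffAt_uncurry_chartConj (by simp))
  filter_upwards [eventually_differentiableAt_chartMul_right, mul_left, conj]
    with x hright hleft hconj Y
  have hconj' : HasFDerivAt (chartConj E (φ₁⁻¹ x)) (chartAd E G x) (φ₁ 1) :=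
    (hasFDerivAt_comp_prodMk_right hconj).differentiableAt.hasFDerivAt
  have hmul := hasFDerivAt_comp_prodMk_left hleft
  rw [← chartConj_base (E := E) (φ₁⁻¹ x)] at hmul
  have hcomp := hmul.comp (φ₁ 1) hconj'
  rw [chartConj_base] at hcomp
  rw [fderiv_apply_prodMk_zero_left hright,
    EventuallyEq.fderiv_eq (eventually_chartMul_eq_chartMul_chartConj (G := G) x)]
  exact DFunLike.congr_fun hcomp.fderiv Y

theorem chartInvariantField_apply (v : 𝔤) {x : E} (hx : x ∈ (φ₁).target)
    (hmul : DifferentiableAt ℝ (chartMul E G) (x, φ₁ 1)) :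
    chartInvariantField v x =
      fderiv ℝ (chartMul E G) (x, φ₁ 1) (0, groupLieAlgebraEquiv E G v) := by
  have chart_diff : MDiffAt φ₁ (φ₁⁻¹ x) :=
    mdifferentiableAt_extChartAt (by simpa only [extChartAt_source] using (φ₁).map_target hx)
  have mul_diff : MDiffAt (fun y : G => φ₁⁻¹ x * y) 1 :=
    contMDiff_mul_left.contMDiffAt.mdifferentiableAt (n := ∞) (by simp)
  have comp_diff : MDiffAt (φ₁ ∘ fun y : G => φ₁⁻¹ x * y) 1 :=
    MDifferentiableAt.comp_of_eq (I' := 𝓘(ℝ, E)) (1 : G) chart_diff mul_diff (mul_one _)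
  exact (mpullbackWithin_extChartAt_symm_apply _ hx).trans <|
    (mfderiv_comp_apply_of_eq (1 : G) chart_diff mul_diff (mul_one _) v).symm.trans <|
    (ContinuousLinearMap.ext_iff.1 (mfderiv_eq_fderiv_extChartAt comp_diff) v).trans
      (fderiv_apply_prodMk_zero_left hmul _).symm

theorem chartInvariantField_eventuallyEq (v : 𝔤) :
    chartInvariantField v =ᶠ[𝓝 (φ₁ 1)]
      fun x => fderiv ℝ (chartMul E G) (x, φ₁ 1) (0, groupLieAlgebraEquiv E G v) := by
  filter_upwards [eventually_differentiableAt_chartMul_right,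
    extChartAt_target_mem_nhds (I := 𝓘(ℝ, E)) (1 : G)] with x hmul hx
  exact chartInvariantField_apply v hx hmul

theorem groupLieAlgebraEquiv_lie_eq_lieBracket_chartInvariantField (ξ Y : 𝔤) :
    groupLieAlgebraEquiv E G ⁅ξ, Y⁆ =
      VectorField.lieBracket ℝ (chartInvariantField ξ) (chartInvariantField Y) (φ₁ 1) := by
  have inverse_eq : ∀ L : E →L[ℝ] E, L = .id ℝ E → ∀ w, L.inverse w = w := by
    rintro _ rfl w
    rw [ContinuousLinearMap.inverse_id]
    rfl
  have univ_eq : φ₁⁻¹ ⁻¹' Set.univ ∩ Set.range 𝓘(ℝ, E) = Set.univ := by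
    simp
  rw [← VectorField.lieBracketWithin_univ, ← univ_eq]
  exact inverse_eq (mfderiv% φ₁ 1) mfderiv_extChartAt_self _

theorem groupLieAlgebraEquiv_lie (ξ Y : 𝔤) :
    groupLieAlgebraEquiv E G ⁅ξ, Y⁆ = VectorField.lieBracket ℝ
      (fun x => fderiv ℝ (chartMul E G) (x, φ₁ 1) (0, groupLieAlgebraEquiv E G ξ))
      (fun x => fderiv ℝ (chartMul E G) (x, φ₁ 1) (0, groupLieAlgebraEquiv E G Y)) (φ₁ 1) := by
  rw [groupLieAlgebraEquiv_lie_eq_lieBracket_chartInvariantField]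
  exact (chartInvariantField_eventuallyEq ξ).lieBracket_vectorField_eq
    (chartInvariantField_eventuallyEq Y)

theorem Ad_chartOne_symm_apply (x : E) :
    Ad E G (φ₁⁻¹ x) = (endGroupLieAlgebraEquiv E G).symm (chartAd E G x) := by
  ext1 Y
  exact Ad_apply_eq_fderiv_chartConj _ (groupLieAlgebraEquiv E G Y)

theorem contMDiff_Ad : CMDiff ∞ (Ad E G) := by
  have at_one : CMDiffAt ∞ (Ad E G) 1 := by
    have chart : CMDiffAt ∞ (fun g : G => chartAd E G (φ₁ g)) 1 :=
      ContMDiffAt.comp (I' := 𝓘(ℝ, E)) (1 : G) contDiffAt_chartAd.contMDiffAt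
        contMDiffAt_extChartAt
    refine ((endGroupLieAlgebraEquiv E G).symm.contDiff.contMDiff.contMDiffAt.comp
      (1 : G) chart).congr_of_eventuallyEq ?_
    filter_upwards [extChartAt_source_mem_nhds (I := 𝓘(ℝ, E)) (1 : G)] with g hg
    rw [Function.comp_apply, ← Ad_chartOne_symm_apply, (φ₁).left_inv hg]
  intro g
  have translate : CMDiffAt ∞ (fun x => Ad E G (g⁻¹ * x)) g := by
    refine ContMDiffAt.comp (I' := 𝓘(ℝ, E)) g ?_ contMDiff_mul_left.contMDiffAt
    rwa [inv_mul_cancel]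
  have Ad_eq : Ad E G = fun x => Ad E G g * Ad E G (g⁻¹ * x) := by
    ext1 x
    rw [← map_mul, mul_inv_cancel_left]
  rw [Ad_eq]
  exact (ContinuousLinearMap.mul ℝ (𝔤 →L[ℝ] 𝔤) (Ad E G g)).contDiff.contMDiff.contMDiffAt.comp
    g translate

theorem mdifferentiableAt_Ad (g : G) : MDiffAt (Ad E G) g :=
  contMDiff_Ad.contMDiffAt.mdifferentiableAt (by simp)

theorem mfderiv_Ad_one_eq_fderiv_chartAd (ξ : 𝔤) :
    mfderiv% (Ad E G) 1 ξ = (endGroupLieAlgebraEquiv E G).symm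
      (fderiv ℝ (chartAd E G) (φ₁ 1) (groupLieAlgebraEquiv E G ξ)) := by
  have Ad_comp_symm : Ad E G ∘ φ₁⁻¹ = (endGroupLieAlgebraEquiv E G).symm ∘ chartAd E G :=
    funext Ad_chartOne_symm_apply
  have hderiv : HasFDerivAt (Ad E G ∘ φ₁⁻¹) _ (φ₁ 1) :=
    Ad_comp_symm ▸ (endGroupLieAlgebraEquiv E G).symm.hasFDerivAt.comp (φ₁ 1)
      (contDiffAt_chartAd.differentiableAt (by simp)).hasFDerivAt
  exact (ContinuousLinearMap.ext_iff.1 (mfderiv_eq_fderiv_extChartAt (mdifferentiableAt_Ad 1))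
    (groupLieAlgebraEquiv E G ξ)).trans (DFunLike.congr_fun hderiv.fderiv _)

variable [FiniteDimensional ℝ E] [CompleteSpace E]

/-- `ad ξ` as a continuous linear map. -/
noncomputable def adCLM (ξ : 𝔤) : 𝔤 →L[ℝ] 𝔤 :=
  LinearMap.toContinuousLinearMap (LieAlgebra.ad ℝ 𝔤 ξ)

theorem adCLM_apply (ξ Y : 𝔤) : adCLM ξ Y = ⁅ξ, Y⁆ := rfl

theorem mfderiv_Ad_one (ξ : 𝔤) : mfderiv% (Ad E G) 1 ξ = adCLM ξ := by
  refine (mfderiv_Ad_one_eq_fderiv_chartAd ξ).trans (ContinuousLinearMap.ext fun Y =>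
    (groupLieAlgebraEquiv E G).injective ?_)
  rw [adCLM_apply, groupLieAlgebraEquiv_lie]
  exact fderiv_conj_eq_lieBracket (contDiffAt_chartMul.of_le ENat.LEInfty.out)
    eventually_chartMul_base_right (contDiffAt_chartAd.differentiableAt (by simp)) chartAd_base
    eventually_fderiv_chartMul_eq _ _

end ChartAtOne

/-! ### Orbits of smooth representations -/

section LinearActions

variable {G : Type*} [Group G] {V : Type*} [NormedAddCommGroup V] [NormedSpace ℝ V]
  {ρ : G →* (V →L[ℝ] V)}

theorem action_mul_apply (g h : G) (v : V) : ρ (g * h) v = ρ g (ρ h v) := by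
  rw [map_mul, mul_apply_eq_comp]

theorem action_one_apply (v : V) : ρ 1 v = v := by
  rw [map_one, one_apply_eq_self]

theorem action_inv_apply_self (g : G) (v : V) : ρ g⁻¹ (ρ g v) = v := by
  rw [← action_mul_apply, inv_mul_cancel, action_one_apply]

theorem action_apply_mem_orbit {v w : V} (g : G) (hw : w ∈ orbit ρ v) : ρ g w ∈ orbit ρ v := by
  obtain ⟨h, rfl⟩ := hw
  exact ⟨g * h, action_mul_apply g h v⟩

theorem orbit_eq_of_mem {v w : V} (hw : w ∈ orbit ρ v) : orbit ρ w = orbit ρ v :=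
  Set.ext fun _ => ⟨(orbitSetoid ρ).trans hw, (orbitSetoid ρ).trans ((orbitSetoid ρ).symm hw)⟩

theorem image_mem_nhdsWithin_orbit [TopologicalSpace G] [IsTopologicalGroup G] [CompactSpace G]
    {v : V} (hρ : Continuous fun g => ρ g v) {N : Set G} (hN : N ∈ 𝓝 (1 : G)) :
    (fun g => ρ g v) '' N ∈ 𝓝[orbit ρ v] v := by
  -- Saturate `N` by the stabilizer: the complement is compact, and its compact image misses `v`.
  let U : Set G := ⋃ s ∈ {s : G | ρ s v = v}, (fun g => g * s⁻¹) ⁻¹' interior N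
  have isOpen_U : IsOpen U := isOpen_biUnion fun s _ =>
    isOpen_interior.preimage (continuous_mul_const _)
  have isClosed_image : IsClosed ((fun g => ρ g v) '' Uᶜ) :=
    (isOpen_U.isClosed_compl.isCompact.image hρ).isClosed
  have v_notMem : v ∉ (fun g => ρ g v) '' Uᶜ := by
    rintro ⟨k, hk, hkv⟩
    refine hk (Set.mem_biUnion (x := k) hkv ?_)
    rw [Set.mem_preimage, mul_inv_cancel]
    exact mem_interior_iff_mem_nhds.2 hN
  filter_upwards [mem_nhdsWithin_of_mem_nhds (isClosed_image.isOpen_compl.mem_nhds v_notMem),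
    self_mem_nhdsWithin] with w hw hw_orbit
  obtain ⟨g, rfl⟩ := hw_orbit
  have hg : g ∈ U := by
    by_contra h
    exact hw ⟨g, h, rfl⟩
  obtain ⟨s, hs, hgs⟩ := Set.mem_iUnion₂.1 hg
  have inv_fixes : ρ s⁻¹ v = v := (congrArg (ρ s⁻¹) hs).symm.trans (action_inv_apply_self s v)
  refine ⟨g * s⁻¹, interior_subset hgs, ?_⟩
  exact (action_mul_apply g s⁻¹ v).trans (congrArg (ρ g) inv_fixes)

end LinearActions

section SmoothOrbits

variable {E : Type*} [NormedAddCommGroup E] [NormedSpace ℝ E]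
  {G : Type*} [TopologicalSpace G] [ChartedSpace E G] [Group G]
  {V : Type*} [NormedAddCommGroup V] [NormedSpace ℝ V]
  {F : Type*} [NormedAddCommGroup F] [NormedSpace ℝ F]
  {M : Type*} [TopologicalSpace M] [ChartedSpace F M]

local notation "𝔤" => GroupLieAlgebra 𝓘(ℝ, E) G
local notation "φ₁" => extChartAt 𝓘(ℝ, E) (1 : G)
local notation "φ₁⁻¹" => PartialEquiv.symm (extChartAt 𝓘(ℝ, E) (1 : G))

/-- The right logarithmic derivative `dg · g⁻¹` of a map `g` into `G`. -/
noncomputable def rightLogDeriv (g : M → G) (y : M) : TangentSpace 𝓘(ℝ, F) y →L[ℝ] 𝔤 :=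
  (mfderiv% (fun x => g x * (g y)⁻¹) y :)

variable {ρ : G →* (V →L[ℝ] V)}

variable (E) in
/-- The linear map `ξ ↦ fundamentalField ρ ξ v`. -/
noncomputable def fundamentalMap (ρ : G →* (V →L[ℝ] V)) (v : V) : 𝔤 →L[ℝ] V :=
  (mfderiv% (fun g : G => ρ g v) 1 :)

variable (E) in
/-- The dimension of the orbit of `v`, as the rank of the orbit map at the identity. -/
noncomputable def orbitRank (ρ : G →* (V →L[ℝ] V)) (v : V) : ℕ :=
  Module.finrank ℝ (fundamentalMap E ρ v).range

theorem contMDiff_orbitMap (hρ : CMDiff ∞ ρ) (v : V) : CMDiff ∞ fun g : G => ρ g v :=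
  (ContinuousLinearMap.apply ℝ V v).contDiff.contMDiff.comp hρ

theorem mdifferentiableAt_orbitMap (hρ : CMDiff ∞ ρ) (v : V) (g : G) :
    MDiffAt (fun g : G => ρ g v) g :=
  (contMDiff_orbitMap hρ v).contMDiffAt.mdifferentiableAt (by simp)

theorem finrank_range_fderiv_orbitMap_chartOne_symm (hρ : CMDiff ∞ ρ) (v : V) :
    Module.finrank ℝ (fderiv ℝ (fun x => ρ (φ₁⁻¹ x) v) (φ₁ 1)).range = orbitRank E ρ v := by
  have hderiv : fderiv ℝ (fun x => ρ (φ₁⁻¹ x) v) (φ₁ 1) = (fundamentalMap E ρ v : E →L[ℝ] V) :=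
    (mfderiv_eq_fderiv_extChartAt (mdifferentiableAt_orbitMap hρ v 1)).symm
  rw [hderiv]
  rfl

variable [LieGroup 𝓘(ℝ, E) ∞ G]

theorem mdifferentiableAt_mul_const {g : M → G} {y : M} (hg : MDiffAt g y) (c : G) :
    MDiffAt (fun x => g x * c) y :=
  MDifferentiableAt.comp (I' := 𝓘(ℝ, E)) y
    ((contMDiff_mul_right (n := ∞) (a := c)).contMDiffAt.mdifferentiableAt (by simp)) hg

theorem mfderiv_action_comp (hρ : CMDiff ∞ ρ) {g : M → G} {y : M} (hg : MDiffAt g y) (v : V)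
    (b : TangentSpace 𝓘(ℝ, F) y) :
    mfderiv% (fun x => ρ (g x) v) y b =
      fundamentalField ρ (rightLogDeriv g y b : 𝔤) (ρ (g y) v) := by
  have translate : (fun x => ρ (g x) v) = fun x => ρ (g x * (g y)⁻¹) (ρ (g y) v) := by
    ext1 x
    rw [← action_mul_apply, inv_mul_cancel_right]
  rw [translate]
  exact mfderiv_comp_apply_of_eq y (mdifferentiableAt_orbitMap hρ _ 1)
    (mdifferentiableAt_mul_const hg _) (mul_inv_cancel _) b

theorem fundamentalField_action_apply (hρ : CMDiff ∞ ρ) (g : G) (ξ : 𝔤) (v : V) :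
    fundamentalField ρ ξ (ρ g v) = ρ g (fundamentalField ρ (Ad E G g⁻¹ ξ) v) := by
  have conj : (fun x : G => ρ x (ρ g v)) = ρ g ∘ fun x : G => ρ (g⁻¹ * x * g⁻¹⁻¹) v := by
    ext1 x
    rw [Function.comp_apply, ← action_mul_apply, ← action_mul_apply]
    congr 2
    group
  have hconj : MDiffAt (fun x : G => g⁻¹ * x * g⁻¹⁻¹) 1 :=
    (contMDiff_conj g⁻¹).contMDiffAt.mdifferentiableAt (by simp)
  have horbit : MDiffAt (fun x : G => ρ (g⁻¹ * x * g⁻¹⁻¹) v) 1 :=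
    MDifferentiableAt.comp (I' := 𝓘(ℝ, E)) (1 : G) (mdifferentiableAt_orbitMap hρ v _) hconj
  rw [fundamentalField, conj]
  exact (ContinuousLinearMap.ext_iff.1
    ((ρ g).hasMFDerivAt.comp (1 : G) horbit.hasMFDerivAt).mfderiv ξ).trans <| congrArg (ρ g)
      (mfderiv_comp_apply_of_eq (1 : G) (mdifferentiableAt_orbitMap hρ v 1) hconj (by simp) ξ)

theorem orbitRank_action_apply_le [FiniteDimensional ℝ V] (hρ : CMDiff ∞ ρ) (g : G) (v : V) :
    orbitRank E ρ (ρ g v) ≤ orbitRank E ρ v := by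
  refine le_trans (Submodule.finrank_mono ?_)
    (Submodule.finrank_map_le (ρ g).toLinearMap (fundamentalMap E ρ v).range)
  rintro _ ⟨ξ, rfl⟩
  exact ⟨fundamentalMap E ρ v (Ad E G g⁻¹ ξ), ⟨_, rfl⟩,
    (fundamentalField_action_apply hρ g ξ v).symm⟩

theorem orbitRank_eq_of_mem [FiniteDimensional ℝ V] (hρ : CMDiff ∞ ρ) {v w : V}
    (hw : w ∈ orbit ρ v) : orbitRank E ρ w = orbitRank E ρ v := by
  obtain ⟨g, rfl⟩ := hw
  refine le_antisymm (orbitRank_action_apply_le hρ g v) ?_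
  simpa only [action_inv_apply_self] using orbitRank_action_apply_le hρ g⁻¹ (ρ g v)

theorem eventually_contDiffAt_orbitMap_chartOne_symm (hρ : CMDiff ∞ ρ) (v : V) :
    ∀ᶠ x in 𝓝 (φ₁ 1), ContDiffAt ℝ ∞ (fun x => ρ (φ₁⁻¹ x) v) x := by
  filter_upwards [eventually_contMDiffAt_extChartAt_symm (mem_extChartAt_target (1 : G))]
    with x hx
  rw [← contMDiffAt_iff_contDiffAt]
  exact (contMDiff_orbitMap hρ v).contMDiffAt.comp x hx

theorem eventually_finrank_range_fderiv_orbitMap_chartOne_symm_le [FiniteDimensional ℝ V]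
    (hρ : CMDiff ∞ ρ) (v : V) : ∀ᶠ x in 𝓝 (φ₁ 1),
      Module.finrank ℝ (fderiv ℝ (fun x => ρ (φ₁⁻¹ x) v) x).range ≤ orbitRank E ρ v := by
  filter_upwards [eventually_contMDiffAt_extChartAt_symm (mem_extChartAt_target (1 : G))]
    with x hx
  rw [← orbitRank_eq_of_mem hρ ⟨φ₁⁻¹ x, rfl⟩]
  refine Submodule.finrank_mono ?_
  rintro _ ⟨b, rfl⟩
  have hb := mfderiv_action_comp hρ (hx.mdifferentiableAt (by simp)) v b
  rw [mfderiv_eq_fderiv] at hb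
  exact ⟨rightLogDeriv φ₁⁻¹ x b, hb.symm⟩

/-- `γ` is a smooth local section at `v` of the orbit map `g ↦ ρ g v`, in the linear coordinates
`P` on the orbit. -/
structure IsOrbitSection {W : Type*} [NormedAddCommGroup W] [NormedSpace ℝ W]
    (ρ : G →* (V →L[ℝ] V)) (v : V) (P : V →L[ℝ] W) (γ : W → G) : Prop where
  contMDiffAt : ∀ᶠ t in 𝓝 (P v), CMDiffAt ∞ γ t
  apply_base : γ (P v) = 1
  right_inv : ∀ᶠ t in 𝓝 (P v), P (ρ (γ t) v) = t
  left_inv : ∀ᶠ w in 𝓝[orbit ρ v] v, ρ (γ (P w)) v = w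

theorem IsConstantRankSection.isOrbitSection [CompactSpace G] {W : Type*} [NormedAddCommGroup W]
    [NormedSpace ℝ W] (hρ : CMDiff ∞ ρ) {v : V} {P : V →L[ℝ] W} {γ : W → E}
    (h : IsConstantRankSection (fun x => ρ (φ₁⁻¹ x) v) (φ₁ 1) P γ) :
    IsOrbitSection (E := E) ρ v P fun t => φ₁⁻¹ (γ t) := by
  have := topologicalGroup_of_lieGroup 𝓘(ℝ, E) ∞ (G := G)
  have base : ρ (φ₁⁻¹ (φ₁ 1)) v = v := by rw [chartOne_symm_apply, action_one_apply]
  obtain ⟨contDiffAt, apply_base, right_inv, factorization⟩ := h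
  simp only [base] at contDiffAt apply_base right_inv
  have tendsto_γ : Tendsto γ (𝓝 (P v)) (𝓝 (φ₁ 1)) :=
    apply_base ▸ contDiffAt.self_of_nhds.continuousAt
  refine ⟨?_, by rw [apply_base, chartOne_symm_apply], right_inv, ?_⟩
  · filter_upwards [contDiffAt, tendsto_γ.eventually
      (eventually_contMDiffAt_extChartAt_symm (mem_extChartAt_target (1 : G)))] with t hγ hφ
    exact ContMDiffAt.comp (I' := 𝓘(ℝ, E)) t hφ hγ.contMDiffAt
  · have near_one : ∀ᶠ g in 𝓝 (1 : G), ρ (φ₁⁻¹ (γ (P (ρ g v)))) v = ρ g v := by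
      filter_upwards [(continuousAt_extChartAt (I := 𝓘(ℝ, E)) (1 : G)).eventually factorization,
        extChartAt_source_mem_nhds (I := 𝓘(ℝ, E)) (1 : G)] with g hg hgs
      rwa [(φ₁).left_inv hgs] at hg
    filter_upwards [image_mem_nhdsWithin_orbit (contMDiff_orbitMap hρ v).continuous near_one]
    rintro _ ⟨g, hg, rfl⟩
    exact hg

theorem exists_isOrbitSection [FiniteDimensional ℝ E] [FiniteDimensional ℝ V] [CompactSpace G]
    (hρ : CMDiff ∞ ρ) (v : V) :
    ∃ (P : V →L[ℝ] EuclideanSpace ℝ (Fin (orbitRank E ρ v)))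
      (γ : EuclideanSpace ℝ (Fin (orbitRank E ρ v)) → G), IsOrbitSection (E := E) ρ v P γ := by
  obtain ⟨P, γ, h⟩ := exists_isConstantRankSection
    (eventually_contDiffAt_orbitMap_chartOne_symm hρ v)
    (finrank_range_fderiv_orbitMap_chartOne_symm hρ v)
    (eventually_finrank_range_fderiv_orbitMap_chartOne_symm_le hρ v)
  exact ⟨P, _, h.isOrbitSection hρ⟩

variable (E) in
theorem exists_contMDiffAt_section_of_mem_orbit [FiniteDimensional ℝ E] [FiniteDimensional ℝ V]
    [CompactSpace G] (hρ : CMDiff ∞ ρ) {v : V} (p : orbit ρ v) :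
    ∃ k : V → G, CMDiffAt ∞ k p.1 ∧ k p = 1 ∧ ∀ᶠ q : orbit ρ v in 𝓝 p, ρ (k q) p = q := by
  obtain ⟨P, γ, h⟩ := exists_isOrbitSection hρ p.1
  refine ⟨fun w => γ (P w), ?_, h.apply_base, ?_⟩
  · exact h.contMDiffAt.self_of_nhds.comp p.1 P.contDiff.contMDiff.contMDiffAt
  · have left_inv := orbit_eq_of_mem p.2 ▸ h.left_inv
    filter_upwards [continuous_subtype_val.continuousAt.eventually
      (eventually_nhdsWithin_iff.1 left_inv)] with q hq
    exact hq q.2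

end SmoothOrbits

/-! ### Embedded submanifolds from local parametrizations -/

section LocalParametrizations

variable {V : Type*} [NormedAddCommGroup V] [NormedSpace ℝ V]
  {W : Type*} [NormedAddCommGroup W] [NormedSpace ℝ W]

/-- `h` is a smooth parametrization of `S` near `v` whose inverse is the linear map `P`. -/
structure IsLocalParametrization (S : Set V) (v : V) (P : V →L[ℝ] W) (h : W → V) : Prop where
  mem : ∀ t, h t ∈ S
  contDiffAt : ∀ᶠ t in 𝓝 (P v), ContDiffAt ℝ ∞ h t
  right_inv : ∀ᶠ t in 𝓝 (P v), P (h t) = t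
  left_inv : ∀ᶠ w in 𝓝[S] v, h (P w) = w

theorem IsLocalParametrization.exists_chart {S : Set V} {v : S} {P : V →L[ℝ] W} {h : W → V}
    (H : IsLocalParametrization S (v : V) P h) :
    ∃ c : OpenPartialHomeomorph S W, v ∈ c.source ∧ (∀ p, c p = P p) ∧
      (∀ t, (c.symm t : V) = h t) ∧ ∀ t ∈ c.target, ContDiffAt ℝ ∞ h t ∧ P (h t) = t := by
  obtain ⟨U, hU, isOpen_U, v_mem_U⟩ := eventually_nhds_iff.1 (H.contDiffAt.and H.right_inv)
  obtain ⟨N, hN, isOpen_N, v_mem_N⟩ :=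
    eventually_nhds_iff.1 (eventually_nhdsWithin_iff.1 H.left_inv)
  have continuousOn_h : ContinuousOn h U := fun t ht =>
    (hU t ht).1.continuousAt.continuousWithinAt
  have continuous_P : Continuous fun p : S => P p := P.continuous.comp continuous_subtype_val
  exact ⟨
    { toFun := fun p => P p
      invFun := fun t => ⟨h t, H.mem t⟩
      source := {p | (p : V) ∈ N ∧ P p ∈ U}
      target := U ∩ h ⁻¹' N
      map_source' := fun p hp => ⟨hp.2, by rw [Set.mem_preimage, hN p hp.1 p.2]; exact hp.1⟩
      map_target' := fun t ht => ⟨ht.2, by rw [(hU t ht.1).2]; exact ht.1⟩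
      left_inv' := fun p hp => Subtype.ext (hN p hp.1 p.2)
      right_inv' := fun t ht => (hU t ht.1).2
      open_source := (isOpen_N.preimage continuous_subtype_val).inter
        (isOpen_U.preimage continuous_P)
      open_target := continuousOn_h.isOpen_inter_preimage isOpen_U isOpen_N
      continuousOn_toFun := continuous_P.continuousOn
      continuousOn_invFun := Topology.IsInducing.subtypeVal.continuousOn_iff.2
        (continuousOn_h.mono Set.inter_subset_left) },
    ⟨v_mem_N, v_mem_U⟩, fun _ => rfl, fun _ => rfl, fun t ht => hU t ht.1⟩

/-- The translation along the fibres of `P` that carries the image of the section `h` of `P` to the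
image of the section `k`. -/
noncomputable def fibreTranslation (P : V →L[ℝ] W) (h k : W → V) (w : V) : V :=
  k (P w) + (w - h (P w))

section FibreTranslation

variable {P : V →L[ℝ] W} {h k : W → V} {U : Set W}

theorem fibreTranslation_apply_section {t : W} (ht : P (h t) = t) :
    fibreTranslation P h k (h t) = k t := by
  rw [fibreTranslation, ht, sub_self, add_zero]

theorem contDiffOn_fibreTranslation (hh : ContDiffOn ℝ ∞ h U) (hk : ContDiffOn ℝ ∞ k U) :
    ContDiffOn ℝ ∞ (fibreTranslation P h k) (P ⁻¹' U) :=
  (hk.comp P.contDiff.contDiffOn fun _ hw => hw).add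
    (contDiffOn_id.sub (hh.comp P.contDiff.contDiffOn fun _ hw => hw))

theorem apply_fibreTranslation (hPh : ∀ t ∈ U, P (h t) = t) (hPk : ∀ t ∈ U, P (k t) = t) {w : V}
    (hw : P w ∈ U) : P (fibreTranslation P h k w) = P w := by
  rw [fibreTranslation, map_add, map_sub, hPh _ hw, hPk _ hw, sub_self, add_zero]

theorem fibreTranslation_fibreTranslation (hPh : ∀ t ∈ U, P (h t) = t)
    (hPk : ∀ t ∈ U, P (k t) = t) {w : V} (hw : P w ∈ U) :
    fibreTranslation P k h (fibreTranslation P h k w) = w := by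
  rw [fibreTranslation, apply_fibreTranslation hPh hPk hw, fibreTranslation]
  abel

theorem exists_fibreTranslation_mem_maximalAtlas (hU : IsOpen U) (hh : ContDiffOn ℝ ∞ h U)
    (hk : ContDiffOn ℝ ∞ k U) (hPh : ∀ t ∈ U, P (h t) = t) (hPk : ∀ t ∈ U, P (k t) = t) :
    ∃ ψ ∈ IsManifold.maximalAtlas 𝓘(ℝ, V) ∞ V, ψ.source = P ⁻¹' U ∧
      ∀ w, ψ w = fibreTranslation P h k w := by
  let ψ : OpenPartialHomeomorph V V :=
    { toFun := fibreTranslation P h k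
      invFun := fibreTranslation P k h
      source := P ⁻¹' U
      target := P ⁻¹' U
      map_source' := fun w hw => by rwa [Set.mem_preimage, apply_fibreTranslation hPh hPk hw]
      map_target' := fun w hw => by rwa [Set.mem_preimage, apply_fibreTranslation hPk hPh hw]
      left_inv' := fun w hw => fibreTranslation_fibreTranslation hPh hPk hw
      right_inv' := fun w hw => fibreTranslation_fibreTranslation hPk hPh hw
      open_source := hU.preimage P.continuous
      open_target := hU.preimage P.continuous
      continuousOn_toFun := (contDiffOn_fibreTranslation hh hk).continuousOn
      continuousOn_invFun := (contDiffOn_fibreTranslation hk hh).continuousOn }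
  refine ⟨ψ, StructureGroupoid.mem_maximalAtlas_of_mem_groupoid _ ?_, rfl, fun _ => rfl⟩
  rw [contDiffGroupoid, mem_groupoid_of_pregroupoid]
  constructor
  · have : ContDiffOn ℝ ∞ ψ ψ.source := contDiffOn_fibreTranslation hh hk
    simpa [contDiffPregroupoid] using this
  · have : ContDiffOn ℝ ∞ ψ.symm ψ.target := contDiffOn_fibreTranslation hk hh
    simpa [contDiffPregroupoid] using this

end FibreTranslation

theorem IsLocalParametrization.exists_straightening {S : Set V} {v : V} {P : V →L[ℝ] W}
    {h : W → V} (H : IsLocalParametrization S v P h) :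
    ∃ ψ ∈ IsManifold.maximalAtlas 𝓘(ℝ, V) ∞ V, v ∈ ψ.source ∧
      ∃ s : W →L[ℝ] V, Function.Injective s ∧ ∀ t, P (h t) = t → ψ (h t) = s t := by
  obtain ⟨U, hU, isOpen_U, v_mem_U⟩ := eventually_nhds_iff.1 (H.contDiffAt.and H.right_inv)
  let s := fderiv ℝ h (P v)
  have hPs (t : W) : P (s t) = t := by
    have hcomp := P.hasFDerivAt.comp (P v)
      (H.contDiffAt.self_of_nhds.differentiableAt (by simp)).hasFDerivAt
    exact ContinuousLinearMap.ext_iff.1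
      (hcomp.unique ((hasFDerivAt_id (P v)).congr_of_eventuallyEq H.right_inv)) t
  obtain ⟨ψ, mem_atlas, hsource, hψ⟩ := exists_fibreTranslation_mem_maximalAtlas isOpen_U
    (fun t ht => (hU t ht).1.contDiffWithinAt) s.contDiff.contDiffOn (fun t ht => (hU t ht).2)
    (fun t _ => hPs t)
  exact ⟨ψ, mem_atlas, hsource ▸ v_mem_U, s, Function.LeftInverse.injective hPs,
    fun t ht => (hψ _).trans (fibreTranslation_apply_section ht)⟩

theorem exists_equiv_prod_apply_zero [FiniteDimensional ℝ V] {d : ℕ}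
    (s : EuclideanSpace ℝ (Fin d) →L[ℝ] V) (hs : Function.Injective s) :
    ∃ L : (EuclideanSpace ℝ (Fin d) × EuclideanSpace ℝ (Fin (Module.finrank ℝ V - d))) ≃L[ℝ] V,
      ∀ t, L (t, 0) = s t := by
  obtain ⟨C, hC⟩ := Submodule.exists_isCompl s.range
  let e := LinearEquiv.ofInjective s.toLinearMap hs
  have finrank_range : Module.finrank ℝ s.range = d := by
    rw [← e.finrank_eq, finrank_euclideanSpace_fin]
  have finrank_add := Submodule.finrank_add_eq_of_isCompl hC
  let k : EuclideanSpace ℝ (Fin (Module.finrank ℝ V - d)) ≃ₗ[ℝ] C :=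
    LinearEquiv.ofFinrankEq _ _ (by rw [finrank_euclideanSpace_fin]; omega)
  refine ⟨((e.prodCongr k).trans (Submodule.prodEquivOfIsCompl _ C hC)).toContinuousLinearEquiv,
    fun t => ?_⟩
  simp [e]

theorem isEmbeddedSubmanifold_of_isLocalParametrization [FiniteDimensional ℝ V] {S : Set V} {d : ℕ}
    (H : ∀ v : S, ∃ (P : V →L[ℝ] EuclideanSpace ℝ (Fin d)) (h : EuclideanSpace ℝ (Fin d) → V),
      IsLocalParametrization S (v : V) P h) :
    IsEmbeddedSubmanifold S := by
  choose P h H using H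
  choose c mem_c hcP hch hc using fun v => (H v).exists_chart
  choose ψ mem_atlas mem_ψ s hs hψ using fun v => (H v).exists_straightening
  choose L hL using fun v => exists_equiv_prod_apply_zero (s v) (hs v)
  let inst : ChartedSpace (EuclideanSpace ℝ (Fin d)) S :=
    { atlas := Set.range c
      chartAt := c
      mem_chart_source := mem_c
      chart_mem_atlas := fun v => ⟨v, rfl⟩ }
  have isManifold : IsManifold (𝓡 d) ∞ S := by
    refine isManifold_of_contDiffOn _ _ _ ?_
    rintro _ _ ⟨v, rfl⟩ ⟨w, rfl⟩ t ht
    have transition_eq : c w ∘ (c v).symm = P w ∘ h v := by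
      ext1 t
      rw [Function.comp_apply, hcP, hch, Function.comp_apply]
    have ht' : t ∈ (c v).target := by
      have := ht.1
      simp only [modelWithCornersSelf_coe_symm, Set.preimage_id, mfld_simps] at this
      exact this.1
    have smooth : ContDiffAt ℝ ∞ (c w ∘ (c v).symm) t :=
      transition_eq ▸ (P w).contDiff.contDiffAt.comp t (hc v t ht').1
    exact smooth.contDiffWithinAt
  refine ⟨d, inst, isManifold, IsImmersionOfComplement.isImmersion
    (F := EuclideanSpace ℝ (Fin (Module.finrank ℝ V - d))) fun v => ?_,
    Topology.IsEmbedding.subtypeVal⟩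
  refine IsImmersionAtOfComplement.mk_of_continuousAt continuous_subtype_val.continuousAt (L v)
    (c v) (ψ v) (mem_c v) (mem_ψ v) (IsManifold.subset_maximalAtlas ⟨v, rfl⟩) (mem_atlas v) ?_
  intro t ht
  have ht' : t ∈ (c v).target := by simpa using ht
  exact (congrArg (ψ v) (hch v t)).trans ((hψ v t (hc v t ht').2).trans (hL v t).symm)

end LocalParametrizations

section OrbitSubmanifold

variable {E : Type*} [NormedAddCommGroup E] [NormedSpace ℝ E]
  {G : Type*} [TopologicalSpace G] [ChartedSpace E G] [Group G]
  {V : Type*} [NormedAddCommGroup V] [NormedSpace ℝ V]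
  {W : Type*} [NormedAddCommGroup W] [NormedSpace ℝ W] {ρ : G →* (V →L[ℝ] V)}

theorem IsOrbitSection.isLocalParametrization (hρ : CMDiff ∞ ρ) {v : V} {P : V →L[ℝ] W}
    {γ : W → G} (h : IsOrbitSection (E := E) ρ v P γ) :
    IsLocalParametrization (orbit ρ v) v P fun t => ρ (γ t) v where
  mem t := ⟨γ t, rfl⟩
  contDiffAt := h.contMDiffAt.mono fun t ht =>
    contMDiffAt_iff_contDiffAt.1 ((contMDiff_orbitMap hρ v).contMDiffAt.comp t ht)
  right_inv := h.right_inv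
  left_inv := h.left_inv

theorem isEmbeddedSubmanifold_orbit [LieGroup 𝓘(ℝ, E) ∞ G] [FiniteDimensional ℝ E]
    [FiniteDimensional ℝ V] [CompactSpace G] (hρ : CMDiff ∞ ρ) (v : V) :
    IsEmbeddedSubmanifold (orbit ρ v) := by
  refine isEmbeddedSubmanifold_of_isLocalParametrization (d := orbitRank E ρ v) fun w => ?_
  have hsection := exists_isOrbitSection hρ w.1
  rw [orbitRank_eq_of_mem hρ w.2] at hsection
  obtain ⟨P, γ, h⟩ := hsection
  have hparam := h.isLocalParametrization hρ
  exact ⟨P, _, orbit_eq_of_mem w.2 ▸ hparam⟩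

end OrbitSubmanifold

/-! ### Tangent spaces of orbits and orbit spaces -/

section SubmanifoldStructures

variable {V : Type*} [NormedAddCommGroup V] [NormedSpace ℝ V]
  {S : Set V} {d : ℕ} [ChartedSpace (EuclideanSpace ℝ (Fin d)) S]
  {F : Type*} [NormedAddCommGroup F] [NormedSpace ℝ F]
  {M : Type*} [TopologicalSpace M] [ChartedSpace F M]

theorem IsSubmanifoldStructure.contMDiff_val (hS : IsSubmanifoldStructure S d) :
    ContMDiff (𝓡 d) 𝓘(ℝ, V) ∞ (Subtype.val : S → V) :=
  hS.2.isImmersion.contMDiff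

theorem IsSubmanifoldStructure.mdifferentiableAt_val (hS : IsSubmanifoldStructure S d) (p : S) :
    MDifferentiableAt (𝓡 d) 𝓘(ℝ, V) (Subtype.val : S → V) p :=
  hS.contMDiff_val.contMDiffAt.mdifferentiableAt (by simp)

theorem IsSubmanifoldStructure.contMDiffAt_of_val (hS : IsSubmanifoldStructure S d)
    {f : M → S} {x : M}
    (hf : CMDiffAt ∞ (fun y => (f y : V)) x) : ContMDiffAt 𝓘(ℝ, F) (𝓡 d) ∞ f x := by
  have := hS.1
  rw [ContMDiffAt.iff_comp_isImmersionAt (hS.2.isImmersion.isImmersionAt (f x))]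
  exact ⟨Topology.IsInducing.subtypeVal.continuousAt_iff.2 hf.continuousAt, hf⟩

theorem IsSubmanifoldStructure.mfderiv_val_comp (hS : IsSubmanifoldStructure S d) {f : M → S}
    {x : M} (hf : MDifferentiableAt 𝓘(ℝ, F) (𝓡 d) f x) (b : TangentSpace 𝓘(ℝ, F) x) :
    mfderiv% (fun y => (f y : V)) x b =
      tangentInclusion S d (f x) (mfderiv 𝓘(ℝ, F) (𝓡 d) f x b) :=
  ContinuousLinearMap.ext_iff.1 (mfderiv_comp x (hS.mdifferentiableAt_val (f x)) hf) b

theorem IsSubmanifoldStructure.tangentInclusion_injective_of_retraction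
    (hS : IsSubmanifoldStructure S d) {p : S} {r : V → S}
    (hr : MDifferentiableAt 𝓘(ℝ, V) (𝓡 d) r (p : V)) (retracts : ∀ᶠ q : S in 𝓝 p, r q = q) :
    Function.Injective (tangentInclusion S d p) := by
  have left_inv (u : TangentSpace (𝓡 d) p) :
      mfderiv 𝓘(ℝ, V) (𝓡 d) r (p : V) (tangentInclusion S d p u) = u :=
    (mfderiv_comp_apply p hr (hS.mdifferentiableAt_val p) u).symm.trans
      (ContinuousLinearMap.ext_iff.1
        ((hasMFDerivAt_id (I := 𝓡 d) p).congr_of_eventuallyEq retracts).mfderiv u)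
  intro u w huw
  exact (left_inv u).symm.trans ((congrArg (mfderiv 𝓘(ℝ, V) (𝓡 d) r p) huw).trans (left_inv w))

theorem exists_diffeomorph_of_continuousLinearEquiv {W : Type*} [NormedAddCommGroup W]
    [NormedSpace ℝ W] {T : Set W} {d' : ℕ} [ChartedSpace (EuclideanSpace ℝ (Fin d')) T]
    (hS : IsSubmanifoldStructure S d) (hT : IsSubmanifoldStructure T d') (L : V ≃L[ℝ] W)
    (hLS : L '' S = T) : ∃ Φ : S ≃ₘ^∞⟮𝓡 d, 𝓡 d'⟯ T, ∀ x, (Φ x : W) = L x := by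
  have maps_to (x : S) : L x ∈ T := hLS ▸ ⟨x, x.2, rfl⟩
  have symm_maps_to (y : T) : L.symm y ∈ S := by
    obtain ⟨x, hx, hxy⟩ := hLS.superset y.2
    rwa [← hxy, L.symm_apply_apply]
  refine ⟨
    { toFun := fun x => ⟨L x, maps_to x⟩
      invFun := fun y => ⟨L.symm y, symm_maps_to y⟩
      left_inv := fun x => Subtype.ext (L.symm_apply_apply x)
      right_inv := fun y => Subtype.ext (L.apply_symm_apply y)
      contMDiff_toFun := fun x => hT.contMDiffAt_of_val
        ((L.contDiff.contMDiff.comp hS.contMDiff_val) x)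
      contMDiff_invFun := fun y => hS.contMDiffAt_of_val
        ((L.symm.contDiff.contMDiff.comp hT.contMDiff_val) y) }, fun x => rfl⟩

end SubmanifoldStructures

section OrbitTangentSpaces

variable {E : Type*} [NormedAddCommGroup E] [NormedSpace ℝ E]
  {G : Type*} [TopologicalSpace G] [ChartedSpace E G] [Group G]
  {V : Type*} [NormedAddCommGroup V] [NormedSpace ℝ V]
  {ρ : G →* (V →L[ℝ] V)} {v : V} {d : ℕ} [ChartedSpace (EuclideanSpace ℝ (Fin d)) (orbit ρ v)]

local notation "𝔤" => GroupLieAlgebra 𝓘(ℝ, E) G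

theorem fundamentalField_mem_range_tangentInclusion (hρ : CMDiff ∞ ρ)
    (hS : IsSubmanifoldStructure (orbit ρ v) d) (p : orbit ρ v) (ξ : 𝔤) :
    fundamentalField ρ ξ p.1 ∈ Set.range (tangentInclusion (orbit ρ v) d p) := by
  let f : G → orbit ρ v := fun g => ⟨ρ g p.1, action_apply_mem_orbit g p.2⟩
  have hf : MDifferentiableAt 𝓘(ℝ, E) (𝓡 d) f 1 :=
    (hS.contMDiffAt_of_val (contMDiff_orbitMap hρ p.1).contMDiffAt).mdifferentiableAt (by simp)
  have range_eq {q : orbit ρ v} (hq : q = p) : Set.range (tangentInclusion (orbit ρ v) d q) =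
      Set.range (tangentInclusion (orbit ρ v) d p) := by
    rw [hq]
  rw [← range_eq (Subtype.ext (action_one_apply p.1) : f 1 = p)]
  exact ⟨mfderiv 𝓘(ℝ, E) (𝓡 d) f 1 ξ, (hS.mfderiv_val_comp hf ξ).symm⟩

variable [LieGroup 𝓘(ℝ, E) ∞ G] [FiniteDimensional ℝ E] [FiniteDimensional ℝ V] [CompactSpace G]

theorem tangentInclusion_orbit_injective (hρ : CMDiff ∞ ρ)
    (hS : IsSubmanifoldStructure (orbit ρ v) d) (p : orbit ρ v) :
    Function.Injective (tangentInclusion (orbit ρ v) d p) := by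
  obtain ⟨k, hk, -, left_inv⟩ := exists_contMDiffAt_section_of_mem_orbit E hρ p
  let r : V → orbit ρ v := fun w => ⟨ρ (k w) p.1, action_apply_mem_orbit _ p.2⟩
  have hr : ContMDiffAt 𝓘(ℝ, V) (𝓡 d) ∞ r p.1 :=
    hS.contMDiffAt_of_val ((contMDiff_orbitMap hρ p.1).contMDiffAt.comp p.1 hk)
  exact hS.tangentInclusion_injective_of_retraction (hr.mdifferentiableAt (by simp))
    (left_inv.mono fun q hq => Subtype.ext hq)

theorem exists_tangentInclusion_orbit_eq (hρ : CMDiff ∞ ρ)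
    (hS : IsSubmanifoldStructure (orbit ρ v) d) (p : orbit ρ v) :
    ∃ L : TangentSpace (𝓡 d) p →L[ℝ] 𝔤,
      ∀ u, tangentInclusion (orbit ρ v) d p u = fundamentalField ρ (L u) p.1 := by
  obtain ⟨k, hk, apply_base, left_inv⟩ := exists_contMDiffAt_section_of_mem_orbit E hρ p
  have val_eq : (Subtype.val : orbit ρ v → V) =ᶠ[𝓝 p] fun q => ρ (k q.1) p.1 :=
    left_inv.mono fun q hq => hq.symm
  have hkval : MDifferentiableAt (𝓡 d) 𝓘(ℝ, E) (fun q : orbit ρ v => k q.1) p :=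
    (hk.mdifferentiableAt (by simp)).comp p (hS.mdifferentiableAt_val p)
  refine ⟨rightLogDeriv (fun q : orbit ρ v => k q.1) p, fun u => ?_⟩
  have hderiv := mfderiv_action_comp hρ hkval p.1 u
  rw [apply_base, action_one_apply] at hderiv
  exact (ContinuousLinearMap.ext_iff.1 val_eq.mfderiv_eq u).trans hderiv

theorem range_tangentInclusion_orbit (hρ : CMDiff ∞ ρ)
    (hS : IsSubmanifoldStructure (orbit ρ v) d) (p : orbit ρ v) :
    Set.range (tangentInclusion (orbit ρ v) d p) =
      Set.range fun ξ : 𝔤 => fundamentalField ρ ξ p.1 := by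
  apply Set.Subset.antisymm
  · obtain ⟨L, hL⟩ := exists_tangentInclusion_orbit_eq hρ hS p
    rintro _ ⟨u, rfl⟩
    exact ⟨L u, (hL u).symm⟩
  · rintro _ ⟨ξ, rfl⟩
    exact fundamentalField_mem_range_tangentInclusion hρ hS p ξ

end OrbitTangentSpaces

section OrbitSpaces

variable {G : Type*} [Group G] {V : Type*} [NormedAddCommGroup V] [NormedSpace ℝ V]
  {W : Type*} [NormedAddCommGroup W] [NormedSpace ℝ W]
  {ρ : G →* (V →L[ℝ] V)} {ρ' : G →* (W →L[ℝ] W)}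

/-- The coarsest diffeology for which `f` is smooth. -/
@[reducible]
noncomputable def inducedDiffeology {X Y : Type*} [DiffeologicalSpace Y] (f : X → Y) :
    DiffeologicalSpace X where
  plots n := {p | IsPlot (f ∘ p)}
  constant_plots x := DiffeologicalSpace.constant_plots (f x)
  plot_reparam hp hf := DiffeologicalSpace.plot_reparam (X := Y) hp hf
  locality h := DiffeologicalSpace.locality (X := Y) h

theorem dSmooth_orbitSpace_of_lift {f : OrbitSpace ρ → OrbitSpace ρ'} {L : V → W}
    (hL : ContDiff ℝ ∞ L) (hf : ∀ v, f (OrbitSpace.mk ρ v) = OrbitSpace.mk ρ' (L v)) :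
    DSmooth f := by
  suffices h : instDiffeologicalSpaceOrbitSpace ρ ≤ inducedDiffeology f from
    DiffeologicalSpace.le_iff.1 h
  rw [instDiffeologicalSpaceOrbitSpace, DiffeologicalSpace.generateFrom_le_iff]
  rintro n q ⟨p, hp, hq : q = OrbitSpace.mk ρ ∘ p⟩
  rw [hq]
  exact DiffeologicalSpace.isPlot_generatedFrom_of_mem
    ⟨L ∘ p, hL.comp hp, funext fun t => hf (p t)⟩

theorem image_orbit_of_equivariant {L : V → W} (hL : ∀ g v, L (ρ g v) = ρ' g (L v)) (v : V) :
    L '' orbit ρ v = orbit ρ' (L v) := by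
  rw [orbit, ← Set.range_comp]
  exact congrArg Set.range (funext fun g => hL g v)

theorem exists_orbitSpace_equiv (L : V ≃L[ℝ] W) (hL : ∀ g v, L (ρ g v) = ρ' g (L v)) :
    ∃ f : OrbitSpace ρ ≃ OrbitSpace ρ',
      (∀ v, f (OrbitSpace.mk ρ v) = OrbitSpace.mk ρ' (L v)) ∧ DSmooth f ∧ DSmooth f.symm := by
  have mem_orbit_iff (v w : V) : w ∈ orbit ρ v ↔ L w ∈ orbit ρ' (L v) := by
    rw [← image_orbit_of_equivariant hL, L.injective.mem_set_image]
  let f : OrbitSpace ρ ≃ OrbitSpace ρ' := Quotient.congr L.toEquiv mem_orbit_iff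
  have hf (v : V) : f (OrbitSpace.mk ρ v) = OrbitSpace.mk ρ' (L v) := rfl
  refine ⟨f, hf, dSmooth_orbitSpace_of_lift L.contDiff hf,
    dSmooth_orbitSpace_of_lift L.symm.contDiff fun w => ?_⟩
  rw [Equiv.symm_apply_eq, hf, L.apply_symm_apply]

end OrbitSpaces

/-! ### Invariance of the bracket and of the Killing form -/

section AdjointAlgebra

variable {E : Type*} [NormedAddCommGroup E] [NormedSpace ℝ E]
  {G : Type*} [TopologicalSpace G] [ChartedSpace E G] [Group G] [LieGroup 𝓘(ℝ, E) ∞ G]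
  {F : Type*} [NormedAddCommGroup F] [NormedSpace ℝ F]

local notation "𝔤" => GroupLieAlgebra 𝓘(ℝ, E) G

theorem Ad_apply_Ad_inv (g : G) (Y : 𝔤) : Ad E G g (Ad E G g⁻¹ Y) = Y := by
  simpa only [inv_inv] using action_inv_apply_self (ρ := Ad E G) g⁻¹ Y

theorem contMDiff_Ad_inv : CMDiff ∞ fun g : G => Ad E G g⁻¹ :=
  contMDiff_Ad.comp (contMDiff_inv 𝓘(ℝ, E) ∞)

theorem coAd_apply (g : G) (α : StrongDual ℝ 𝔤) (Y : 𝔤) :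
    coAd E G g α Y = α (Ad E G g⁻¹ Y) := rfl

theorem contMDiff_coAd : CMDiff ∞ (coAd E G) := by
  have contDiff_precomp : ContDiff ℝ ∞ (ContinuousLinearMap.compL ℝ 𝔤 𝔤 ℝ).flip :=
    ContinuousLinearMap.contDiff _
  exact contDiff_precomp.contMDiff.comp contMDiff_Ad_inv

variable [FiniteDimensional ℝ E] [CompleteSpace E]

theorem adCLM_lie (ξ η : 𝔤) : adCLM ⁅ξ, η⁆ = adCLM ξ * adCLM η - adCLM η * adCLM ξ := by
  ext Y
  simp [adCLM_apply]

theorem fundamentalField_Ad (ξ Y : 𝔤) : fundamentalField (Ad E G) ξ Y = ⁅ξ, Y⁆ := by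
  let evalAt : (𝔤 →L[ℝ] 𝔤) →L[ℝ] 𝔤 := ContinuousLinearMap.apply ℝ 𝔤 Y
  have deriv_orbitMap :=
    (evalAt.hasMFDerivAt.comp (1 : G) (mdifferentiableAt_Ad (E := E) (1 : G)).hasMFDerivAt).mfderiv
  exact (ContinuousLinearMap.ext_iff.1 deriv_orbitMap ξ).trans (congrArg evalAt (mfderiv_Ad_one ξ))

theorem Ad_lie (g : G) (ξ η : 𝔤) : Ad E G g ⁅ξ, η⁆ = ⁅Ad E G g ξ, Ad E G g η⁆ := by
  rw [← fundamentalField_Ad (Ad E G g ξ), fundamentalField_action_apply contMDiff_Ad,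
    action_inv_apply_self, fundamentalField_Ad]

theorem adCLM_Ad (g : G) (ξ : 𝔤) : adCLM (Ad E G g ξ) = Ad E G g * adCLM ξ * Ad E G g⁻¹ := by
  ext Y
  rw [mul_apply_eq_comp, mul_apply_eq_comp, adCLM_apply, adCLM_apply, Ad_lie, Ad_apply_Ad_inv]

theorem killingForm_Ad (g : G) (X Y : 𝔤) :
    killingForm ℝ 𝔤 (Ad E G g X) (Ad E G g Y) = killingForm ℝ 𝔤 X Y := by
  let e : 𝔤 ≃ₗ⁅ℝ⁆ 𝔤 :=
    { (Ad E G g).toLinearMap with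
      map_lie' := fun {ξ η} => Ad_lie g ξ η
      invFun := Ad E G g⁻¹
      left_inv := action_inv_apply_self g
      right_inv := Ad_apply_Ad_inv g }
  exact LieAlgebra.killingForm_of_equiv_apply e X Y

theorem killingFlat_apply (X Y : 𝔤) : killingFlat E G X Y = killingForm ℝ 𝔤 X Y := rfl

theorem killingFlat_Ad (g : G) (X : 𝔤) :
    killingFlat E G (Ad E G g X) = coAd E G g (killingFlat E G X) := by
  ext Y
  rw [coAd_apply, killingFlat_apply, killingFlat_apply, ← killingForm_Ad g X, Ad_apply_Ad_inv]

theorem killingFlat_bijective (hG : (killingForm ℝ 𝔤).Nondegenerate) :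
    Function.Bijective (killingFlat E G) :=
  (LinearMap.toContinuousLinearMap (𝕜 := ℝ) (E := 𝔤) (F' := ℝ)).bijective.comp
    (LinearMap.BilinForm.toDual _ hG).bijective

theorem fderiv_Ad_comp_apply {g : F → G} {y : F} (hg : MDiffAt g y) (b : F) :
    fderiv ℝ (fun x => Ad E G (g x)) y b =
      adCLM (rightLogDeriv g y b : 𝔤) * Ad E G (g y) := by
  have hAd : DifferentiableAt ℝ (fun x => Ad E G (g x)) y :=
    (MDifferentiableAt.comp (I' := 𝓘(ℝ, E)) y (mdifferentiableAt_Ad _) hg).differentiableAt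
  ext Y
  have deriv_apply : fderiv ℝ (fun x => Ad E G (g x) Y) y b =
      fderiv ℝ (fun x => Ad E G (g x)) y b Y := by
    rw [fderiv_clm_apply hAd (differentiableAt_const Y)]
    simp
  rw [← deriv_apply, ← mfderiv_eq_fderiv, mul_apply_eq_comp, adCLM_apply, ← fundamentalField_Ad]
  exact mfderiv_action_comp contMDiff_Ad hg Y b

theorem fundamentalField_coAd_apply (ξ Y : 𝔤) (ν : StrongDual ℝ 𝔤) :
    fundamentalField (coAd E G) ξ ν Y = -(ν ⁅ξ, Y⁆) := by
  let orbitPair : G → StrongDual ℝ 𝔤 × 𝔤 := fun g => (coAd E G g ν, Ad E G g Y)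
  have deriv_coAd := (mdifferentiableAt_orbitMap contMDiff_coAd ν (1 : G)).hasMFDerivAt
  have deriv_Ad := (mdifferentiableAt_orbitMap contMDiff_Ad Y (1 : G)).hasMFDerivAt
  have deriv_orbitPair : HasMFDerivAt 𝓘(ℝ, E) 𝓘(ℝ, StrongDual ℝ 𝔤 × 𝔤) orbitPair 1
      ((fundamentalMap E (coAd E G) ν).prod (fundamentalMap E (Ad E G) Y)) :=
    ⟨deriv_coAd.1.prodMk deriv_Ad.1, deriv_coAd.2.prodMk deriv_Ad.2⟩
  have deriv_pairing := ((isBoundedBilinearMap_apply (𝕜 := ℝ) (E := 𝔤) (F := ℝ)).hasFDerivAt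
    (orbitPair 1)).hasMFDerivAt.comp (1 : G) deriv_orbitPair
  -- The pairing `(Ad* g ν) (Ad g Y) = ν Y` does not depend on `g`.
  have pairing_const : (fun p : StrongDual ℝ 𝔤 × 𝔤 => p.1 p.2) ∘ orbitPair = fun _ => ν Y := by
    ext g
    simp only [Function.comp_apply, orbitPair, coAd_apply, action_inv_apply_self]
  rw [pairing_const] at deriv_pairing
  have sum_eq_zero :
      (coAd E G 1 ν) (fundamentalField (Ad E G) ξ Y) +
        fundamentalField (coAd E G) ξ ν (Ad E G 1 Y) = 0 :=
    ContinuousLinearMap.ext_iff.1 (hasMFDerivAt_unique deriv_pairing (hasMFDerivAt_const _ _)) ξ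
  rw [action_one_apply, action_one_apply, fundamentalField_Ad] at sum_eq_zero
  exact eq_neg_of_add_eq_zero_right sum_eq_zero

end AdjointAlgebra

/-! ### The Maurer–Cartan form -/

section MaurerCartan

variable {F : Type*} [NormedAddCommGroup F] [NormedSpace ℝ F]
  {W : Type*} [NormedAddCommGroup W] [NormedSpace ℝ W]
  {A : Type*} [NormedRing A] [NormedAlgebra ℝ A]

theorem contDiffAt_and_extDeriv_eq_zero_of_eventuallyEq_extDeriv {n : ℕ}
    {β : F → F [⋀^Fin n]→L[ℝ] W} {τ : F → F [⋀^Fin (n + 1)]→L[ℝ] W} {y : F}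
    (hβ : ContDiffAt ℝ ∞ β y) (hτ : τ =ᶠ[𝓝 y] extDeriv β) :
    ContDiffAt ℝ ∞ τ y ∧ extDeriv τ y = 0 := by
  have contDiffAt_extDeriv : ContDiffAt ℝ ∞ (extDeriv β) y :=
    (ContinuousAlternatingMap.alternatizeUncurryFinCLM ℝ F W).contDiff.contDiffAt.comp y
      (hβ.fderiv_right (by simp))
  refine ⟨contDiffAt_extDeriv.congr_of_eventuallyEq hτ, ?_⟩
  rw [hτ.extDeriv_eq]
  refine extDeriv_extDeriv_apply hβ ?_
  rw [minSmoothness_of_isRCLikeNormedField]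
  exact ENat.LEInfty.out

/-- A map with values in the dual, as a differential 1-form. -/
noncomputable def oneForm (h : F → F →L[ℝ] W) (y : F) : F [⋀^Fin 1]→L[ℝ] W :=
  ContinuousAlternatingMap.ofSubsingletonLIE (𝕜 := ℝ) (E := F) (F := W) (0 : Fin 1) (h y)

theorem contDiffAt_oneForm {h : F → F →L[ℝ] W} {y : F} (hh : ContDiffAt ℝ ∞ h y) :
    ContDiffAt ℝ ∞ (oneForm h) y :=
  (ContinuousAlternatingMap.ofSubsingletonLIE (𝕜 := ℝ) (E := F) (F := W)
    (0 : Fin 1)).toContinuousLinearEquiv.contDiff.contDiffAt.comp y hh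

theorem extDeriv_oneForm_apply {h : F → F →L[ℝ] W} {y : F} (hh : DifferentiableAt ℝ h y)
    (v w : F) : extDeriv (oneForm h) y ![v, w] =
      fderiv ℝ (fun x => h x w) y v - fderiv ℝ (fun x => h x v) y w := by
  have differentiableAt_oneForm : DifferentiableAt ℝ (oneForm h) y :=
    ((ContinuousAlternatingMap.ofSubsingletonLIE (𝕜 := ℝ) (E := F) (F := W)
      (0 : Fin 1)).toContinuousLinearEquiv.differentiableAt).comp y hh
  rw [extDeriv_apply differentiableAt_oneForm, Fin.sum_univ_two]
  simp [oneForm, Fin.removeNth, sub_eq_add_neg]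

/-- The Maurer–Cartan form `b da` of a pair of maps into an algebra, meant for `b = a⁻¹`. -/
noncomputable def maurerCartan (b a : F → A) (y : F) : F →L[ℝ] A :=
  (ContinuousLinearMap.mul ℝ A (b y)).comp (fderiv ℝ a y)

variable {a b : F → A} {y : F}

theorem maurerCartan_apply (v : F) : maurerCartan b a y v = b y * fderiv ℝ a y v := rfl

theorem contDiffAt_maurerCartan (ha : ContDiffAt ℝ ∞ a y) (hb : ContDiffAt ℝ ∞ b y) :
    ContDiffAt ℝ ∞ (maurerCartan b a) y :=
  ((ContinuousLinearMap.mul ℝ A).contDiff.contDiffAt.comp y hb).clm_comp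
    (ha.fderiv_right (by simp))

theorem fderiv_eq_neg_mul_mul_of_mul_eq_one (ha : DifferentiableAt ℝ a y)
    (hb : DifferentiableAt ℝ b y) (hba : b * a = 1) (hab : a y * b y = 1) (v : F) :
    fderiv ℝ b y v = -(b y * fderiv ℝ a y v * b y) := by
  have deriv_mul := hb.hasFDerivAt.mul' ha.hasFDerivAt
  rw [hba] at deriv_mul
  have leibniz : b y * fderiv ℝ a y v + fderiv ℝ b y v * a y = 0 :=
    ContinuousLinearMap.ext_iff.1 (deriv_mul.unique (hasFDerivAt_const (1 : A) y)) v
  calc fderiv ℝ b y v = fderiv ℝ b y v * a y * b y := by rw [mul_assoc, hab, mul_one]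
    _ = -(b y * fderiv ℝ a y v * b y) := by rw [eq_neg_of_add_eq_zero_right leibniz, neg_mul]

theorem fderiv_maurerCartan_apply (ha : ContDiffAt ℝ 2 a y) (hb : DifferentiableAt ℝ b y)
    (hba : b * a = 1) (hab : a y * b y = 1) (v w : F) :
    fderiv ℝ (fun x => maurerCartan b a x w) y v =
      b y * fderiv ℝ (fderiv ℝ a) y v w - maurerCartan b a y v * maurerCartan b a y w := by
  have ha' : DifferentiableAt ℝ (fderiv ℝ a) y :=
    (ha.fderiv_right (m := 1) (by norm_num)).differentiableAt (by simp)
  have deriv_mul := (hb.hasFDerivAt.mul'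
    (ha'.hasFDerivAt.clm_apply (hasFDerivAt_const w y))).fderiv
  have deriv_b := fderiv_eq_neg_mul_mul_of_mul_eq_one (ha.differentiableAt (by simp)) hb hba hab v
  refine (ContinuousLinearMap.ext_iff.1 deriv_mul v).trans ?_
  simp [deriv_b, maurerCartan_apply, mul_assoc, sub_eq_add_neg]

theorem extDeriv_maurerCartan_apply (ha : ContDiffAt ℝ 2 a y) (hb : DifferentiableAt ℝ b y)
    (hba : b * a = 1) (hab : a y * b y = 1) (lam : A →L[ℝ] W) (v w : F) :
    extDeriv (oneForm fun x => lam.comp (maurerCartan b a x)) y ![v, w] =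
      -lam (maurerCartan b a y v * maurerCartan b a y w -
        maurerCartan b a y w * maurerCartan b a y v) := by
  have ha' : DifferentiableAt ℝ (fderiv ℝ a) y :=
    (ha.fderiv_right (m := 1) (by norm_num)).differentiableAt (by simp)
  have differentiableAt_maurerCartan : DifferentiableAt ℝ (maurerCartan b a) y :=
    ((ContinuousLinearMap.mul ℝ A).differentiableAt.comp y hb).clm_comp ha'
  have deriv_lam (v w : F) : fderiv ℝ (fun x => lam (maurerCartan b a x w)) y v =
      lam (fderiv ℝ (fun x => maurerCartan b a x w) y v) :=
    ContinuousLinearMap.ext_iff.1 (lam.hasFDerivAt.comp y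
      (differentiableAt_maurerCartan.clm_apply
        (differentiableAt_const w)).hasFDerivAt).fderiv v
  have second_deriv_symm : fderiv ℝ (fderiv ℝ a) y v w = fderiv ℝ (fderiv ℝ a) y w v :=
    (ha.isSymmSndFDerivAt (by rw [minSmoothness_of_isRCLikeNormedField])).eq v w
  rw [extDeriv_oneForm_apply ((differentiableAt_const lam).clm_comp differentiableAt_maurerCartan)]
  simp only [ContinuousLinearMap.comp_apply, deriv_lam,
    fderiv_maurerCartan_apply ha hb hba hab, second_deriv_symm, ← map_sub, ← map_neg]
  congr 1
  abel

end MaurerCartan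

section KKSForms

variable {E : Type*} [NormedAddCommGroup E] [NormedSpace ℝ E]
  {G : Type*} [TopologicalSpace G] [ChartedSpace E G] [Group G] [LieGroup 𝓘(ℝ, E) ∞ G]
  {F : Type*} [NormedAddCommGroup F] [NormedSpace ℝ F]

local notation "𝔤" => GroupLieAlgebra 𝓘(ℝ, E) G

theorem contDiffAt_Ad_comp {n : ℕ∞ω} (hn : n ≤ ∞) {g : F → G} {y : F} (hg : CMDiffAt n g y) :
    ContDiffAt ℝ n (fun x => Ad E G (g x)) y :=
  contMDiffAt_iff_contDiffAt.1 <|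
    ContMDiffAt.comp (I' := 𝓘(ℝ, E)) y (contMDiff_Ad.contMDiffAt.of_le hn) hg

theorem fderiv_eq_fundamentalField_coAd {α : StrongDual ℝ 𝔤} {g : F → G} {y : F}
    {ν : F → StrongDual ℝ 𝔤} (hg : MDiffAt g y) (hν : ν =ᶠ[𝓝 y] fun x => coAd E G (g x) α)
    (v : F) : fderiv ℝ ν y v = fundamentalField (coAd E G) (rightLogDeriv g y v : 𝔤) (ν y) := by
  rw [hν.fderiv_eq, hν.self_of_nhds, ← mfderiv_eq_fderiv]
  exact mfderiv_action_comp contMDiff_coAd hg α v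

theorem contDiffAt_Ad_inv_comp {n : ℕ∞ω} (hn : n ≤ ∞) {g : F → G} {y : F}
    (hg : CMDiffAt n g y) :
    ContDiffAt ℝ n (fun x => Ad E G (g x)⁻¹) y :=
  contMDiffAt_iff_contDiffAt.1 <|
    ContMDiffAt.comp (I' := 𝓘(ℝ, E)) (g := fun x : G => Ad E G x⁻¹) y
      (contMDiff_Ad_inv.contMDiffAt.of_le hn) hg

variable [FiniteDimensional ℝ E] [CompleteSpace E]

/-- The linear form `T ↦ tr (ad X ∘ T)`. -/
noncomputable def traceAd (X : 𝔤) : (𝔤 →L[ℝ] 𝔤) →L[ℝ] ℝ :=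
  LinearMap.toContinuousLinearMap
    (LinearMap.trace ℝ 𝔤 ∘ₗ ContinuousLinearMap.coeLM ℝ ∘ₗ LinearMap.mulLeft ℝ (adCLM X))

theorem killingFlat_eq_traceAd (X ξ : 𝔤) : killingFlat E G X ξ = traceAd X (adCLM ξ) :=
  killingForm_apply_apply ℝ _ X ξ

theorem maurerCartan_Ad_apply {g : F → G} {y : F} (hg : MDiffAt g y) (v : F) :
    maurerCartan (fun x => Ad E G (g x)⁻¹) (fun x => Ad E G (g x)) y v =
      adCLM (Ad E G (g y)⁻¹ (rightLogDeriv g y v : 𝔤)) := by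
  rw [maurerCartan_apply, fderiv_Ad_comp_apply hg, adCLM_Ad, inv_inv, mul_assoc]

theorem extDeriv_maurerCartan_Ad_apply {α : StrongDual ℝ 𝔤} {lam : (𝔤 →L[ℝ] 𝔤) →L[ℝ] ℝ}
    (hα : ∀ ξ, α ξ = lam (adCLM ξ)) {g : F → G} {y : F} (hg : CMDiffAt 2 g y) (v w : F) :
    extDeriv (oneForm fun x =>
        lam.comp (maurerCartan (fun z => Ad E G (g z)⁻¹) (fun z => Ad E G (g z)) x)) y ![v, w] =
      -(coAd E G (g y) α ⁅(rightLogDeriv g y v : 𝔤), (rightLogDeriv g y w : 𝔤)⁆) := by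
  have hg' : MDiffAt g y := hg.mdifferentiableAt (by simp)
  have Ad_inv_mul (x : G) : Ad E G x⁻¹ * Ad E G x = 1 := by
    rw [← map_mul, inv_mul_cancel, map_one]
  have Ad_mul_inv (x : G) : Ad E G x * Ad E G x⁻¹ = 1 := by
    rw [← map_mul, mul_inv_cancel, map_one]
  rw [extDeriv_maurerCartan_apply (contDiffAt_Ad_comp ENat.LEInfty.out hg)
      ((contDiffAt_Ad_inv_comp ENat.LEInfty.out hg).differentiableAt (by simp))
      (funext fun x => Ad_inv_mul (g x)) (Ad_mul_inv (g y)),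
    maurerCartan_Ad_apply hg', maurerCartan_Ad_apply hg', ← adCLM_lie, ← Ad_lie, ← hα, coAd_apply]

/-- If `α = λ ∘ ad`, the Kirillov-Kostant-Souriau form along `ν = Ad*(g) α` is the exterior
derivative of the 1-form `λ (Ad(g)⁻¹ d Ad(g))`. -/
theorem contDiffAt_and_extDeriv_eq_zero_of_kks {α : StrongDual ℝ 𝔤}
    {lam : (𝔤 →L[ℝ] 𝔤) →L[ℝ] ℝ} (hα : ∀ ξ, α ξ = lam (adCLM ξ)) {g : F → G} {y₀ : F}
    (hg : CMDiffAt ∞ g y₀) {ν : F → StrongDual ℝ 𝔤} (hν : ν =ᶠ[𝓝 y₀] fun y => coAd E G (g y) α)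
    {τ : F → F [⋀^Fin 2]→L[ℝ] ℝ}
    (hτ : ∀ᶠ y in 𝓝 y₀, ∀ (v w : F) (ξ η : 𝔤),
      fderiv ℝ ν y v = fundamentalField (coAd E G) ξ (ν y) →
      fderiv ℝ ν y w = fundamentalField (coAd E G) η (ν y) → τ y ![v, w] = -(ν y ⁅ξ, η⁆)) :
    ContDiffAt ℝ ∞ τ y₀ ∧ extDeriv τ y₀ = 0 := by
  have contDiffAt_form := contDiffAt_maurerCartan (contDiffAt_Ad_comp le_rfl hg)
    (contDiffAt_Ad_inv_comp le_rfl hg)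
  refine contDiffAt_and_extDeriv_eq_zero_of_eventuallyEq_extDeriv
    (contDiffAt_oneForm (contDiffAt_const (c := lam).clm_comp contDiffAt_form)) ?_
  have : IsManifold 𝓘(ℝ, E) 2 G := .of_le (n := ∞) ENat.LEInfty.out
  have hg_nhds : ∀ᶠ y in 𝓝 y₀, CMDiffAt 2 g y :=
    (contMDiffAt_iff_contMDiffAt_nhds (by simp)).1 (hg.of_le ENat.LEInfty.out)
  filter_upwards [hν.eventually_nhds, hτ, hg_nhds] with y hνy hτy hgy
  have hgy' : MDiffAt g y := hgy.mdifferentiableAt (by simp)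
  ext v
  have hv : v = ![v 0, v 1] := List.ofFn_inj.mp rfl
  rw [hv, hτy _ _ _ _ (fderiv_eq_fundamentalField_coAd hgy' hνy _)
    (fderiv_eq_fundamentalField_coAd hgy' hνy _), extDeriv_maurerCartan_Ad_apply hα hgy,
    hνy.self_of_nhds]

end KKSForms

/-! ### The Kirillov-Kostant-Souriau form -/

section PullbackForms

variable {E : Type*} [NormedAddCommGroup E] [NormedSpace ℝ E]
  {M : Type*} [TopologicalSpace M] [ChartedSpace E M]
  {E' : Type*} [NormedAddCommGroup E'] [NormedSpace ℝ E']
  {M' : Type*} [TopologicalSpace M'] [ChartedSpace E' M']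

theorem TwoForm.pullback_apply (f : M → M') (σ : TwoForm E' M') (p : M)
    (u v : TangentSpace 𝓘(ℝ, E) p) :
    TwoForm.pullback (E := E) f σ p ![u, v] = σ (f p) ![mfderiv% f p u, mfderiv% f p v] := by
  change σ (f p) _ = σ (f p) _
  congr 1
  ext1 i
  fin_cases i <;> rfl

theorem TwoForm.inChart_apply (σ : TwoForm E M) (x : M) (y u v : E) :
    σ.inChart x y ![u, v] =
      σ ((extChartAt 𝓘(ℝ, E) x).symm y)
        ![mfderiv% (extChartAt 𝓘(ℝ, E) x).symm y u, mfderiv% (extChartAt 𝓘(ℝ, E) x).symm y v] := by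
  change σ _ _ = σ _ _
  congr 1
  ext1 i
  fin_cases i <;> rfl

theorem TwoForm.pullback_id (σ : TwoForm E M) : TwoForm.pullback id σ = σ := by
  funext p
  ext v
  change σ p _ = σ p v
  congr 1
  ext1 i
  exact ContinuousLinearMap.ext_iff.1 (mfderiv_id (I := 𝓘(ℝ, E)) (x := p)) (v i)

theorem TwoForm.eq_zero_of_pullback_apply_eq_zero (Φ : M ≃ₘ^∞⟮𝓘(ℝ, E), 𝓘(ℝ, E')⟯ M')
    {σ : TwoForm E' M'} {p : M}
    (hσ : ∀ u : TangentSpace 𝓘(ℝ, E') (Φ p),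
      (∀ v : TangentSpace 𝓘(ℝ, E') (Φ p), σ (Φ p) ![u, v] = 0) → u = 0)
    {u : TangentSpace 𝓘(ℝ, E) p}
    (hu : ∀ v : TangentSpace 𝓘(ℝ, E) p, TwoForm.pullback (E := E) Φ σ p ![u, v] = 0) : u = 0 := by
  let D := Φ.mfderivToContinuousLinearEquiv (by simp) p
  have D_eq_zero : D u = 0 := by
    refine hσ (D u) fun v => ?_
    obtain ⟨w, rfl⟩ := D.surjective v
    exact (TwoForm.pullback_apply Φ σ p u w).symm.trans (hu w)
  exact D.injective (D_eq_zero.trans (map_zero D).symm)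

end PullbackForms

section KirillovKostantSouriau

variable {E : Type*} [NormedAddCommGroup E] [NormedSpace ℝ E]
  [FiniteDimensional ℝ E] [CompleteSpace E]
  {G : Type*} [TopologicalSpace G] [ChartedSpace E G] [Group G] [LieGroup 𝓘(ℝ, E) ∞ G]

local notation "𝔤" => GroupLieAlgebra 𝓘(ℝ, E) G

theorem continuous_adCLM : Continuous (adCLM : 𝔤 → 𝔤 →L[ℝ] 𝔤) :=
  LinearMap.continuous_of_finiteDimensional (𝕜 := ℝ)
    { toFun := (adCLM : 𝔤 → 𝔤 →L[ℝ] 𝔤)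
      map_add' := fun ξ η => ContinuousLinearMap.ext fun Y => add_lie ξ η Y
      map_smul' := fun c ξ => ContinuousLinearMap.ext fun Y => smul_lie c ξ Y }

/-- The alternating form `(ξ, η) ↦ -ν [ξ, η]` on the Lie algebra. -/
noncomputable def negLieForm (ν : StrongDual ℝ 𝔤) : 𝔤 [⋀^Fin 2]→L[ℝ] ℝ where
  toFun w := -(ν ⁅w 0, w 1⁆)
  map_update_add' w i x y := by
    fin_cases i <;> simp <;> ring
  map_update_smul' w i c x := by
    fin_cases i <;> simp
  cont := (ν.continuous.comp ((continuous_adCLM.comp (continuous_apply (0 : Fin 2))).clm_apply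
    (continuous_apply (1 : Fin 2)))).neg
  map_eq_zero_of_eq' w i j hw hij := by
    have w_eq : w 0 = w 1 := by
      fin_cases i <;> fin_cases j <;> first | exact absurd rfl hij | exact hw | exact hw.symm
    rw [w_eq, lie_self, map_zero, neg_zero]

theorem apply_lie_eq_of_fundamentalField_coAd_eq {ν : StrongDual ℝ 𝔤} {ξ ξ' : 𝔤}
    (h : fundamentalField (coAd E G) ξ ν = fundamentalField (coAd E G) ξ' ν) (Y : 𝔤) :
    ν ⁅ξ, Y⁆ = ν ⁅ξ', Y⁆ := by
  have h_apply := ContinuousLinearMap.ext_iff.1 h Y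
  rw [fundamentalField_coAd_apply, fundamentalField_coAd_apply] at h_apply
  exact neg_injective h_apply

variable [CompactSpace G] {α : StrongDual ℝ (GroupLieAlgebra 𝓘(ℝ, E) G)} {d : ℕ}
  [ChartedSpace (EuclideanSpace ℝ (Fin d)) (orbit (coAd E G) α)]

theorem exists_isKKSForm (hS : IsSubmanifoldStructure (orbit (coAd E G) α) d) :
    ∃ σ : TwoForm (EuclideanSpace ℝ (Fin d)) (orbit (coAd E G) α), IsKKSForm α d σ := by
  choose L hL using fun ν => exists_tangentInclusion_orbit_eq contMDiff_coAd hS ν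
  refine ⟨fun ν => (negLieForm ν.1).compContinuousLinearMap (L ν), ?_⟩
  intro ν u v ξ η hu hv
  change -(ν.1 ⁅L ν u, L ν v⁆) = _
  rw [apply_lie_eq_of_fundamentalField_coAd_eq ((hL ν u).symm.trans hu), ← lie_skew, map_neg,
    apply_lie_eq_of_fundamentalField_coAd_eq ((hL ν v).symm.trans hv), ← map_neg, lie_skew]

variable {σ : TwoForm (EuclideanSpace ℝ (Fin d)) (orbit (coAd E G) α)}

theorem IsKKSForm.nondegenerate (hS : IsSubmanifoldStructure (orbit (coAd E G) α) d)
    (hσ : IsKKSForm α d σ) (ν : orbit (coAd E G) α) (u : TangentSpace (𝓡 d) ν)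
    (hu : ∀ v : TangentSpace (𝓡 d) ν, σ ν ![u, v] = 0) : u = 0 := by
  obtain ⟨L, hL⟩ := exists_tangentInclusion_orbit_eq contMDiff_coAd hS ν
  refine tangentInclusion_orbit_injective contMDiff_coAd hS ν ?_
  rw [map_zero, hL u]
  ext Y
  obtain ⟨v, hv⟩ := fundamentalField_mem_range_tangentInclusion contMDiff_coAd hS ν Y
  rw [fundamentalField_coAd_apply, ← hσ ν u v (L u) Y (hL u) hv, hu]
  rfl

variable {lam : (GroupLieAlgebra 𝓘(ℝ, E) G →L[ℝ] GroupLieAlgebra 𝓘(ℝ, E) G) →L[ℝ] ℝ}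

theorem IsKKSForm.contDiffAt_and_extDeriv_eq_zero {F : Type*} [NormedAddCommGroup F]
    [NormedSpace ℝ F] (hα : ∀ ξ, α ξ = lam (adCLM ξ))
    (hS : IsSubmanifoldStructure (orbit (coAd E G) α) d)
    (hσ : IsKKSForm α d σ) {Ψ : F → orbit (coAd E G) α} {y₀ : F}
    (hΨ : ∀ᶠ y in 𝓝 y₀, ContMDiffAt 𝓘(ℝ, F) (𝓡 d) ∞ Ψ y) {τ : F → F [⋀^Fin 2]→L[ℝ] ℝ}
    (hτ : ∀ᶠ y in 𝓝 y₀, ∀ v w : F, τ y ![v, w] =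
      σ (Ψ y) ![mfderiv 𝓘(ℝ, F) (𝓡 d) Ψ y v, mfderiv 𝓘(ℝ, F) (𝓡 d) Ψ y w]) :
    ContDiffAt ℝ ∞ τ y₀ ∧ extDeriv τ y₀ = 0 := by
  obtain ⟨g₀, hg₀⟩ := (Ψ y₀).2
  obtain ⟨k, contMDiffAt_k, -, hk⟩ :=
    exists_contMDiffAt_section_of_mem_orbit E contMDiff_coAd (Ψ y₀)
  have contMDiffAt_val_Ψ : ContMDiffAt 𝓘(ℝ, F) 𝓘(ℝ, StrongDual ℝ 𝔤) ∞ (fun y => (Ψ y).1) y₀ :=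
    ContMDiffAt.comp (I' := 𝓡 d) y₀ hS.contMDiff_val.contMDiffAt hΨ.self_of_nhds
  have contMDiffAt_lift : ContMDiffAt 𝓘(ℝ, F) 𝓘(ℝ, E) ∞ (fun y => k (Ψ y).1 * g₀) y₀ :=
    (ContMDiffAt.comp (I' := 𝓘(ℝ, StrongDual ℝ 𝔤)) (g := k) y₀ contMDiffAt_k
      contMDiffAt_val_Ψ).mul contMDiffAt_const
  refine contDiffAt_and_extDeriv_eq_zero_of_kks hα contMDiffAt_lift
    (ν := fun y => (Ψ y).1) ?_ ?_
  · filter_upwards [hΨ.self_of_nhds.continuousAt.eventually hk] with y hy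
    rw [action_mul_apply]
    exact (hy.symm.trans (congrArg _ hg₀.symm))
  · filter_upwards [hΨ, hτ] with y hy hτy v w ξ η hv hw
    have deriv_val (u : F) := hS.mfderiv_val_comp (hy.mdifferentiableAt (by simp)) u
    rw [mfderiv_eq_fderiv] at deriv_val
    rw [hτy]
    exact hσ (Ψ y) _ _ ξ η ((deriv_val v).symm.trans hv) ((deriv_val w).symm.trans hw)

variable {d' : ℕ} {M : Type*} [TopologicalSpace M] [ChartedSpace (EuclideanSpace ℝ (Fin d')) M]
  [IsManifold (𝓡 d') ∞ M]

theorem IsKKSForm.contDiffAt_and_extDeriv_eq_zero_inChart_pullback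
    (hα : ∀ ξ, α ξ = lam (adCLM ξ)) (hS : IsSubmanifoldStructure (orbit (coAd E G) α) d)
    (hσ : IsKKSForm α d σ) {f : M → orbit (coAd E G) α} (hf : ContMDiff (𝓡 d') (𝓡 d) ∞ f)
    {x : M} {y : EuclideanSpace ℝ (Fin d')} (hy : y ∈ (extChartAt (𝓡 d') x).target) :
    ContDiffAt ℝ ∞ ((TwoForm.pullback (E := EuclideanSpace ℝ (Fin d')) f σ).inChart x) y ∧
      extDeriv ((TwoForm.pullback (E := EuclideanSpace ℝ (Fin d')) f σ).inChart x) y = 0 := by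
  have contMDiffAt_symm := eventually_contMDiffAt_extChartAt_symm hy
  refine hσ.contDiffAt_and_extDeriv_eq_zero hα hS
    (Ψ := fun z => f ((extChartAt (𝓡 d') x).symm z)) ?_ ?_
  · filter_upwards [contMDiffAt_symm] with z hz
    exact hf.contMDiffAt.comp z hz
  · filter_upwards [contMDiffAt_symm] with z hz v w
    have chain_rule (u : EuclideanSpace ℝ (Fin d')) := mfderiv_comp_apply z
      (hf.contMDiffAt.mdifferentiableAt (by simp)) (hz.mdifferentiableAt (by simp)) u
    rw [TwoForm.inChart_apply, TwoForm.pullback_apply]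
    exact (congrArg₂ (fun a b => σ _ ![a, b]) (chain_rule v) (chain_rule w)).symm

theorem IsKKSForm.isSymplectic_pullback (hα : ∀ ξ, α ξ = lam (adCLM ξ))
    (hS : IsSubmanifoldStructure (orbit (coAd E G) α) d) (hσ : IsKKSForm α d σ)
    (Φ : M ≃ₘ^∞⟮𝓡 d', 𝓡 d⟯ orbit (coAd E G) α) :
    (TwoForm.pullback (E := EuclideanSpace ℝ (Fin d')) Φ σ).IsSymplectic where
  smooth _ _ hy := (hσ.contDiffAt_and_extDeriv_eq_zero_inChart_pullback hα hS Φ.contMDiff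
    hy).1.contDiffWithinAt
  closed _ _ hy :=
    (hσ.contDiffAt_and_extDeriv_eq_zero_inChart_pullback hα hS Φ.contMDiff hy).2
  nondegenerate p _ hu :=
    TwoForm.eq_zero_of_pullback_apply_eq_zero Φ (hσ.nondegenerate hS (Φ p)) hu

theorem IsKKSForm.isSymplectic (hα : ∀ ξ, α ξ = lam (adCLM ξ))
    (hS : IsSubmanifoldStructure (orbit (coAd E G) α) d) (hσ : IsKKSForm α d σ) :
    σ.IsSymplectic := by
  have := hS.1
  rw [← TwoForm.pullback_id σ]
  exact hσ.isSymplectic_pullback hα hS (Diffeomorph.refl (𝓡 d) (orbit (coAd E G) α) ∞)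

end KirillovKostantSouriau

theorem theorem5p0p2_general
    {E : Type*} [NormedAddCommGroup E] [NormedSpace ℝ E] [FiniteDimensional ℝ E] [CompleteSpace E]
    {G : Type*} [TopologicalSpace G] [ChartedSpace E G] [Group G] [LieGroup 𝓘(ℝ, E) ∞ G]
    [CompactSpace G]
    (hG : (killingForm ℝ (GroupLieAlgebra 𝓘(ℝ, E) G)).Nondegenerate) :
    Function.Bijective (killingFlat E G) ∧
    (∀ (g : G) (X : GroupLieAlgebra 𝓘(ℝ, E) G),
      killingFlat E G (Ad E G g X) = coAd E G g (killingFlat E G X)) ∧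
    (∃ Bhat : OrbitSpace (Ad E G) ≃ OrbitSpace (coAd E G),
      (∀ X, Bhat (OrbitSpace.mk (Ad E G) X) = OrbitSpace.mk (coAd E G) (killingFlat E G X)) ∧
      DSmooth Bhat ∧ DSmooth Bhat.symm) ∧
    ∀ X : GroupLieAlgebra 𝓘(ℝ, E) G,
      IsEmbeddedSubmanifold (orbit (Ad E G) X) ∧
      IsEmbeddedSubmanifold (orbit (coAd E G) (killingFlat E G X)) ∧
      ∀ (d d' : ℕ) [ChartedSpace (EuclideanSpace ℝ (Fin d)) (orbit (Ad E G) X)]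
        [ChartedSpace (EuclideanSpace ℝ (Fin d')) (orbit (coAd E G) (killingFlat E G X))],
        IsSubmanifoldStructure (orbit (Ad E G) X) d →
        IsSubmanifoldStructure (orbit (coAd E G) (killingFlat E G X)) d' →
        (∀ ν : orbit (coAd E G) (killingFlat E G X),
          Set.range (tangentInclusion _ d' ν) =
            Set.range fun ξ : GroupLieAlgebra 𝓘(ℝ, E) G => fundamentalField (coAd E G) ξ ν.1) ∧
        ∃ (F : orbit (Ad E G) X ≃ₘ^∞⟮𝓡 d, 𝓡 d'⟯ orbit (coAd E G) (killingFlat E G X))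
          (σ : TwoForm (EuclideanSpace ℝ (Fin d')) (orbit (coAd E G) (killingFlat E G X)))
          (Ω : TwoForm (EuclideanSpace ℝ (Fin d)) (orbit (Ad E G) X)),
          (∀ Y : orbit (Ad E G) X, (F Y).1 = killingFlat E G Y.1) ∧
          IsKKSForm (killingFlat E G X) d' σ ∧ σ.IsSymplectic ∧
          Ω.IsSymplectic ∧ IsSymplectomorphism F Ω σ := by
  have killingFlat_bij := killingFlat_bijective hG
  let L : GroupLieAlgebra 𝓘(ℝ, E) G ≃L[ℝ] StrongDual ℝ (GroupLieAlgebra 𝓘(ℝ, E) G) :=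
    (LinearEquiv.ofBijective (killingFlat E G) killingFlat_bij).toContinuousLinearEquiv
  have L_Ad (g : G) (Y : GroupLieAlgebra 𝓘(ℝ, E) G) : L (Ad E G g Y) = coAd E G g (L Y) :=
    killingFlat_Ad g Y
  refine ⟨killingFlat_bij, killingFlat_Ad, exists_orbitSpace_equiv L L_Ad, fun X =>
    ⟨isEmbeddedSubmanifold_orbit contMDiff_Ad X, isEmbeddedSubmanifold_orbit contMDiff_coAd _, ?_⟩⟩
  intro d d' _ _ hS hS'
  refine ⟨range_tangentInclusion_orbit contMDiff_coAd hS', ?_⟩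
  obtain ⟨F, hF⟩ :=
    exists_diffeomorph_of_continuousLinearEquiv hS hS' L (image_orbit_of_equivariant L_Ad X)
  obtain ⟨σ, hσ⟩ := exists_isKKSForm hS'
  have := hS.1
  have factors := killingFlat_eq_traceAd X
  exact ⟨F, σ, TwoForm.pullback F σ, hF, hσ, hσ.isSymplectic factors hS',
    hσ.isSymplectic_pullback factors hS' F, rfl⟩

theorem theorem5p0p2
    {E : Type*} [NormedAddCommGroup E] [NormedSpace ℝ E] [FiniteDimensional ℝ E] [CompleteSpace E]
    {G : Type*} [TopologicalSpace G] [ChartedSpace E G] [Group G] [LieGroup 𝓘(ℝ, E) ∞ G]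
    [T2Space G] [CompactSpace G] [ConnectedSpace G]
    (hG : (killingForm ℝ (GroupLieAlgebra 𝓘(ℝ, E) G)).Nondegenerate) :
    -- `B♭` is an equivariant linear isomorphism
    Function.Bijective (killingFlat E G) ∧
    (∀ (g : G) (X : GroupLieAlgebra 𝓘(ℝ, E) G),
      killingFlat E G (Ad E G g X) = coAd E G g (killingFlat E G X)) ∧
    -- it descends to a diffeomorphism of the orbit spaces
    (∃ Bhat : OrbitSpace (Ad E G) ≃ OrbitSpace (coAd E G),
      (∀ X, Bhat (OrbitSpace.mk (Ad E G) X) = OrbitSpace.mk (coAd E G) (killingFlat E G X)) ∧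
      DSmooth Bhat ∧ DSmooth Bhat.symm) ∧
    -- and it restricts to a symplectomorphism of every adjoint orbit onto its coadjoint orbit
    ∀ X : GroupLieAlgebra 𝓘(ℝ, E) G,
      IsEmbeddedSubmanifold (orbit (Ad E G) X) ∧
      IsEmbeddedSubmanifold (orbit (coAd E G) (killingFlat E G X)) ∧
      ∀ (d d' : ℕ) [ChartedSpace (EuclideanSpace ℝ (Fin d)) (orbit (Ad E G) X)]
        [ChartedSpace (EuclideanSpace ℝ (Fin d')) (orbit (coAd E G) (killingFlat E G X))],
        IsSubmanifoldStructure (orbit (Ad E G) X) d →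
        IsSubmanifoldStructure (orbit (coAd E G) (killingFlat E G X)) d' →
        (∀ ν : orbit (coAd E G) (killingFlat E G X),
          Set.range (tangentInclusion _ d' ν) =
            Set.range fun ξ : GroupLieAlgebra 𝓘(ℝ, E) G => fundamentalField (coAd E G) ξ ν.1) ∧
        ∃ (F : orbit (Ad E G) X ≃ₘ^∞⟮𝓡 d, 𝓡 d'⟯ orbit (coAd E G) (killingFlat E G X))
          (σ : TwoForm (EuclideanSpace ℝ (Fin d')) (orbit (coAd E G) (killingFlat E G X)))
          (Ω : TwoForm (EuclideanSpace ℝ (Fin d)) (orbit (Ad E G) X)),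
          (∀ Y : orbit (Ad E G) X, (F Y).1 = killingFlat E G Y.1) ∧
          IsKKSForm (killingFlat E G X) d' σ ∧ σ.IsSymplectic ∧
          Ω.IsSymplectic ∧ IsSymplectomorphism F Ω σ :=
  theorem5p0p2_general hG
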